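/- Let $m\ge 2$ and let $f_i(x)=A_ix+b_i$, $i=1,\dots,m$, be affine maps of $\mathbb R^2$ with $f_i([0,1]^2)\subset[0,1]^2$ and $A_i=\operatorname{diag}(h_i,v_i)$, $0<h_i,v_i<1$. Let $E$ be the associated self-affine carpet, i.e. the unique non-empty compact set with $E=\bigcup_{i=1}^m f_i(E)$. Let $p=(p_1,\dots,p_m)$ be a probability vector with $p_i>0$ for all $i$, and let $\nu_p$ be the Bernoulli measure on $E$, i.e. the push-forward of the product measure $p^{\mathbb N}$ on $\{1,\dots,m\}^{\mathbb N}$ under the canonical projection $(i_1,i_2,\dots)\mapsto\sum_{n=1}^\infty A_{i_1}\cdots A_{i_{n-1}}b_{i_n}$. Assume that 1. $f_i([0,1]^2)\cap f_j([0,1]^2)=\emptyset$ for $i\neq j$; 2. $\#\{i\in\{1,\dots,m\}:(\{c\}\times[0,1])\cap f_i([0,1]^2)\neq\emptyset\}\ge 2$ for all $c\in[0,1]$; 3. $-\sum_{i=1}^m\nu_p(f_i([0,1]^2))\log h_i<-\sum_{i=1}^m\nu_p(f_i([0,1]^2))\log v_i$. Then for $\nu_p$-almost every $x$, every tangent set $T$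 of $E$ at $x$ is of the form $T=(\mathbb R\times C)\cap B(0,1)$, where $C\subset\mathbb R$ is a perfect porous set (depending on $x$ and $T$). Here $B(x,r)$ denotes the closed ball. A tangent set of $E$ at $x$ is a limit in the Hausdorff metric of the sets $\{(y-x)/t_n : y\in E\cap B(x,t_n)\}$ along some sequence $t_n\downarrow 0$. A perfect set is a closed set without isolated points. A set $C\subset\mathbb R$ is porous if there is $0<\alpha\le 1$ such that for all $x\in C$ and $0<r<\operatorname{diam}(C)$ there is $y\in\mathbb R$ with $B(y,\alpha r)\subset B(x,r)\setminus C$. -/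

import Mathlib

open Set Filter Topology MeasureTheory

namespace SelfAffine

/-- The Euclidean plane. -/
abbrev Plane : Type := EuclideanSpace ℝ (Fin 2)

/-- The unit square `[0,1]²`. -/
def unitSquare : Set Plane := {x | x 0 ∈ Icc (0 : ℝ) 1 ∧ x 1 ∈ Icc (0 : ℝ) 1}

/-- The vertical segment `{c} × [0,1]`. -/
def verticalSegment (c : ℝ) : Set Plane := {x | x 0 = c ∧ x 1 ∈ Icc (0 : ℝ) 1}

/-- The affine map `x ↦ A x + b` of the plane. -/
noncomputable def affineMap (A : Matrix (Fin 2) (Fin 2) ℝ) (b : Plane) (x : Plane) : Plane :=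
  WithLp.toLp 2 (Matrix.mulVec A x) + b

/-- `E` is the self-affine set of the maps `f₁, …, f_m`: the non-empty compact set which is the
union of its images (for contractions there is exactly one such set). -/
def IsSelfAffineSet {m : ℕ} (f : Fin m → Plane → Plane) (E : Set Plane) : Prop :=
  IsCompact E ∧ E.Nonempty ∧ E = ⋃ i, f i '' E

/-- The canonical projection `π(i₁, i₂, …) = ∑ₙ A_{i₁} ⋯ A_{iₙ₋₁} b_{iₙ}`; the letters of the
infinite word `w` are `w 0, w 1, …`. -/
noncomputable def canonicalProjection {m : ℕ} (A : Fin m → Matrix (Fin 2) (Fin 2) ℝ)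
    (b : Fin m → Plane) (w : ℕ → Fin m) : Plane :=
  ∑' n : ℕ, WithLp.toLp 2 (Matrix.mulVec (List.ofFn fun k : Fin n => A (w k)).prod (b (w n)))

/-- The Bernoulli measure on infinite words: the product of the probability vector `p`. -/
noncomputable def bernoulliMeasure {m : ℕ} (p : PMF (Fin m)) : Measure (ℕ → Fin m) :=
  Measure.infinitePi fun _ : ℕ => p.toMeasure

/-- The Bernoulli measure as a measure on the plane (carried by the self-affine set): the
push-forward under the canonical projection. -/
noncomputable def projectedBernoulli {m : ℕ} (A : Fin m → Matrix (Fin 2) (Fin 2) ℝ)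
    (b : Fin m → Plane) (p : PMF (Fin m)) : Measure Plane :=
  (bernoulliMeasure p).map (canonicalProjection A b)

/-- The scenery of `E` around `x` at scale `t`: the image of `E ∩ B(x,t)` under the zoom
`y ↦ (y - x) / t`. -/
def scenery (E : Set Plane) (x : Plane) (t : ℝ) : Set Plane :=
  (fun y => t⁻¹ • (y - x)) '' (E ∩ Metric.closedBall x t)

/-- `T` is a tangent set of `E` at `x`: a compact set that is the limit in the Hausdorff metric of
sceneries around `x` along scales decreasing to `0`. (The extended Hausdorff distance between
a non-empty set and `∅` is `∞`, so `T` is non-empty if `x ∈ E`.) -/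
def IsTangentSet (E : Set Plane) (x : Plane) (T : Set Plane) : Prop :=
  IsCompact T ∧ ∃ t : ℕ → ℝ, (∀ n, 0 < t n) ∧ Antitone t ∧ Tendsto t atTop (𝓝 0) ∧
    Tendsto (fun n => Metric.hausdorffEDist (scenery E x (t n)) T) atTop (𝓝 0)

/-- (Uniform lower) porosity of a set `A` in a metric space: at each point of `A` and each scale
below the (possibly infinite) diameter there is a hole of comparable size. -/
def IsPorous {X : Type*} [PseudoMetricSpace X] (A : Set X) : Prop :=
  ∃ α : ℝ, 0 < α ∧ α ≤ 1 ∧ ∀ x ∈ A, ∀ r : ℝ, 0 < r → ENNReal.ofReal r < Metric.ediam A →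
    ∃ y : X, Metric.closedBall y (α * r) ⊆ Metric.closedBall x r \ A

/-- The set `ℝ × C` in the plane. -/
def horizontalFibers (C : Set ℝ) : Set Plane := {x | x 1 ∈ C}

end SelfAffine

open SelfAffine

/-!
For a typical word the cylinders around its point `x` are much wider than high, by the strict
inequality between the Lyapunov exponents and the law of large numbers
(`Carpet.exists_ae_eventually_height_div_width_le`). Hence a ball whose radius `t` is comparable to
the height of a cylinder looks, after rescaling this cylinder to the unit square, like a vertical
strip of exponentially small width around the abscissa of the shifted point. The rectangles of the
first generation are separated, so no other cylinder enters the ball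
(`Carpet.mem_cylinder_of_close`).

Fix a finite family of cylinders of small height which cover the carpet. If the strip contains no
end point of their horizontal projections, then each of them that meets the strip crosses it, and
since each vertical line over `[0,1]` meets the carpet, its part of the carpet projects onto the
whole strip. So, up to a small multiple of `t`, the carpet is a union of horizontal segments in the
ball. This is the property `HorizontallyFibred`. That the strips avoid a given abscissa eventually
follows from the Borel–Cantelli lemma and a power bound for the Bernoulli measure of vertical
strips (`Carpet.exists_stripMeasure_le_rpow`). This bound comes from the self-similarity of the
horizontal projection of the measure, since one of the maps fixes the left side of the square
and another one its right side.

At a horizontally fibred point a tangent set `T` is, within the unit disc, the limit of products of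
the line with blow-ups of the slice of the carpet through the point, whence it is a product
(`IsLimitOfProducts.eq_horizontalFibers`). Each slice contains, in each cylinder that it meets, two
subcylinders and a hole, because the vertical line meets at least two disjoint rectangles. So slices
are uniformly perfect and porous, with constants that survive in the limit. The factor `C` is only
determined by `T` on `[-1, 1]`, and its trace there may have isolated points at `±1`. Outside of
this interval a translated slice of the carpet is attached to it at these points.
-/

open SelfAffine

/-! ### The maps of a carpet, their compositions and the attractor -/

namespace SelfAffine

lemma plane_ext {z z' : Plane} (h0 : z 0 = z' 0) (h1 : z 1 = z' 1) : z = z' := by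
  ext i
  fin_cases i
  · exact h0
  · exact h1

/-- The data of a self-affine carpet: the `i`-th map is
`(x, y) ↦ (h i * x + a i, v i * y + d i)`. The images of the unit square lie in the unit square
and are pairwise disjoint, and each vertical line over `[0,1]` meets at least two of them. -/
structure Carpet (m : ℕ) where
  /-- horizontal contraction ratios -/
  h : Fin m → ℝ
  /-- vertical contraction ratios -/
  v : Fin m → ℝ
  /-- horizontal translations -/
  a : Fin m → ℝ
  /-- vertical translations -/
  d : Fin m → ℝ
  h_pos : ∀ i, 0 < h i
  h_lt_one : ∀ i, h i < 1
  v_pos : ∀ i, 0 < v i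
  v_lt_one : ∀ i, v i < 1
  a_nonneg : ∀ i, 0 ≤ a i
  a_add_h_le : ∀ i, a i + h i ≤ 1
  d_nonneg : ∀ i, 0 ≤ d i
  d_add_v_le : ∀ i, d i + v i ≤ 1
  disjoint : ∀ i j, i ≠ j → Disjoint (Icc (a i) (a i + h i) ×ˢ Icc (d i) (d i + v i))
    (Icc (a j) (a j + h j) ×ˢ Icc (d j) (d j + v j))
  cover : ∀ c ∈ Icc (0 : ℝ) 1,
    ∃ i j, i ≠ j ∧ c ∈ Icc (a i) (a i + h i) ∧ c ∈ Icc (a j) (a j + h j)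

namespace Carpet

variable {m : ℕ} (S : Carpet m)

/-- The `i`-th map of the carpet. -/
noncomputable def map (i : Fin m) (z : Plane) : Plane :=
  !₂[S.h i * z 0 + S.a i, S.v i * z 1 + S.d i]

@[simp] lemma map_fst (i : Fin m) (z : Plane) : S.map i z 0 = S.h i * z 0 + S.a i := by
  simp [map]

@[simp] lemma map_snd (i : Fin m) (z : Plane) : S.map i z 1 = S.v i * z 1 + S.d i := by
  simp [map]

/-- The composition of the maps indexed by the letters of a word. -/
noncomputable def wordMap (u : List (Fin m)) (z : Plane) : Plane := u.foldr S.map z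

/-- The width of the rectangle `wordMap u [0,1]²`. -/
noncomputable def width (u : List (Fin m)) : ℝ := (u.map S.h).prod

/-- The height of the rectangle `wordMap u [0,1]²`. -/
noncomputable def height (u : List (Fin m)) : ℝ := (u.map S.v).prod

@[simp] lemma wordMap_nil (z : Plane) : S.wordMap [] z = z := rfl

@[simp] lemma wordMap_cons (i : Fin m) (u : List (Fin m)) (z : Plane) :
    S.wordMap (i :: u) z = S.map i (S.wordMap u z) := rfl

lemma wordMap_append (u u' : List (Fin m)) (z : Plane) :
    S.wordMap (u ++ u') z = S.wordMap u (S.wordMap u' z) := by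
  simp [wordMap]

@[simp] lemma width_nil : S.width [] = 1 := by simp [width]

@[simp] lemma height_nil : S.height [] = 1 := by simp [height]

@[simp] lemma width_cons (i : Fin m) (u : List (Fin m)) :
    S.width (i :: u) = S.h i * S.width u := by simp [width]

@[simp] lemma height_cons (i : Fin m) (u : List (Fin m)) :
    S.height (i :: u) = S.v i * S.height u := by simp [height]

lemma width_append (u u' : List (Fin m)) : S.width (u ++ u') = S.width u * S.width u' := by
  simp [width]

lemma height_append (u u' : List (Fin m)) : S.height (u ++ u') = S.height u * S.height u' := by
  simp [height]

lemma width_pos (u : List (Fin m)) : 0 < S.width u := by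
  induction u with
  | nil => simp
  | cons i u ih => simpa using mul_pos (S.h_pos i) ih

lemma height_pos (u : List (Fin m)) : 0 < S.height u := by
  induction u with
  | nil => simp
  | cons i u ih => simpa using mul_pos (S.v_pos i) ih

lemma wordMap_fst_sub (u : List (Fin m)) (z z' : Plane) :
    S.wordMap u z 0 - S.wordMap u z' 0 = S.width u * (z 0 - z' 0) := by
  induction u with
  | nil => simp
  | cons i u ih =>
    simp only [wordMap_cons, map_fst, width_cons]
    linear_combination S.h i * ih

lemma wordMap_snd_sub (u : List (Fin m)) (z z' : Plane) :
    S.wordMap u z 1 - S.wordMap u z' 1 = S.height u * (z 1 - z' 1) := by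
  induction u with
  | nil => simp
  | cons i u ih =>
    simp only [wordMap_cons, map_snd, height_cons]
    linear_combination S.v i * ih

lemma wordMap_fst (u : List (Fin m)) (z : Plane) :
    S.wordMap u z 0 = S.width u * z 0 + S.wordMap u 0 0 := by
  have := S.wordMap_fst_sub u z 0
  simp only [PiLp.zero_apply, sub_zero] at this
  linarith

lemma wordMap_snd (u : List (Fin m)) (z : Plane) :
    S.wordMap u z 1 = S.height u * z 1 + S.wordMap u 0 1 := by
  have := S.wordMap_snd_sub u z 0
  simp only [PiLp.zero_apply, sub_zero] at this
  linarith

lemma map_mapsTo (i : Fin m) : MapsTo (S.map i) unitSquare unitSquare := by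
  rintro z ⟨⟨h0, h0'⟩, h1, h1'⟩
  have := S.h_pos i; have := S.v_pos i
  have := S.a_nonneg i; have := S.a_add_h_le i; have := S.d_nonneg i; have := S.d_add_v_le i
  refine ⟨⟨?_, ?_⟩, ?_, ?_⟩ <;> simp only [map_fst, map_snd] <;> first | positivity | nlinarith

lemma wordMap_mapsTo (u : List (Fin m)) : MapsTo (S.wordMap u) unitSquare unitSquare := by
  induction u with
  | nil => exact fun z hz => hz
  | cons i u ih => exact fun z hz => S.map_mapsTo i (ih hz)

lemma map_injective (i : Fin m) : Function.Injective (S.map i) := by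
  intro z z' hz
  have h0 := congrArg (fun y : Plane => y 0) hz
  have h1 := congrArg (fun y : Plane => y 1) hz
  simp only [map_fst, map_snd, add_left_inj, mul_eq_mul_left_iff, (S.h_pos i).ne',
    (S.v_pos i).ne', or_false] at h0 h1
  exact plane_ext h0 h1

/-- The coordinates of a point in the image of the unit square under `map i`. -/
lemma map_mem (i : Fin m) {z : Plane} (hz : z ∈ unitSquare) :
    S.map i z 0 ∈ Icc (S.a i) (S.a i + S.h i) ∧ S.map i z 1 ∈ Icc (S.d i) (S.d i + S.v i) := by
  obtain ⟨⟨h0, h0'⟩, h1, h1'⟩ := hz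
  have := S.h_pos i; have := S.v_pos i
  refine ⟨⟨?_, ?_⟩, ?_, ?_⟩ <;> simp only [map_fst, map_snd] <;> nlinarith

lemma map_image_unitSquare (i : Fin m) : S.map i '' unitSquare =
    {z | z 0 ∈ Icc (S.a i) (S.a i + S.h i) ∧ z 1 ∈ Icc (S.d i) (S.d i + S.v i)} := by
  ext z
  constructor
  · rintro ⟨y, hy, rfl⟩
    exact S.map_mem i hy
  · rintro ⟨⟨h0, h0'⟩, h1, h1'⟩
    have hh := S.h_pos i; have hv := S.v_pos i
    refine ⟨!₂[(z 0 - S.a i) / S.h i, (z 1 - S.d i) / S.v i], ⟨⟨?_, ?_⟩, ?_, ?_⟩,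
      plane_ext ?_ ?_⟩
    · simpa using div_nonneg (by linarith) hh.le
    · simpa using (div_le_one hh).2 (by linarith)
    · simpa using div_nonneg (by linarith) hv.le
    · simpa using (div_le_one hv).2 (by linarith)
    · simp; field_simp; ring
    · simp; field_simp; ring

lemma eq_of_map_eq {i j : Fin m} {z z' : Plane} (hz : z ∈ unitSquare) (hz' : z' ∈ unitSquare)
    (h : S.map i z = S.map j z') : i = j ∧ z = z' := by
  by_cases hij : i = j
  · subst hij
    exact ⟨rfl, S.map_injective i h⟩
  · have h1 := S.map_mem i hz
    have h2 := S.map_mem j hz'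
    rw [← h] at h2
    exact ((Set.disjoint_left.1 (S.disjoint i j hij))
      (show (S.map i z 0, S.map i z 1) ∈ _ from h1) h2).elim

/-- The number `g > 0` is a gap of the carpet if points of distinct rectangles of the first
generation differ by at least `g` in one of the two coordinates. -/
def IsGap (g : ℝ) : Prop := 0 < g ∧ ∀ i j, i ≠ j →
  ∀ x ∈ Icc (S.a i) (S.a i + S.h i), ∀ x' ∈ Icc (S.a j) (S.a j + S.h j),
  ∀ y ∈ Icc (S.d i) (S.d i + S.v i), ∀ y' ∈ Icc (S.d j) (S.d j + S.v j),
    |x - x'| < g → g ≤ |y - y'|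

lemma exists_isGap : ∃ g, S.IsGap g := by
  have key : ∀ i j, i ≠ j → ∀ᶠ g : ℝ in 𝓝[>] 0,
      ∀ x ∈ Icc (S.a i) (S.a i + S.h i), ∀ x' ∈ Icc (S.a j) (S.a j + S.h j),
      ∀ y ∈ Icc (S.d i) (S.d i + S.v i), ∀ y' ∈ Icc (S.d j) (S.d j + S.v j),
      |x - x'| < g → g ≤ |y - y'| := by
    intro i j hij
    obtain ⟨r, hr, hr'⟩ := Metric.exists_pos_forall_lt_edist
      (isCompact_Icc.prod isCompact_Icc) (isClosed_Icc.prod isClosed_Icc) (S.disjoint i j hij)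
    filter_upwards [Ioo_mem_nhdsGT (NNReal.coe_pos.2 hr)] with g hg x hx x' hx' y hy y' hy' h
    have := hr' (x, y) ⟨hx, hy⟩ (x', y') ⟨hx', hy'⟩
    rw [edist_nndist, ENNReal.coe_lt_coe, ← NNReal.coe_lt_coe, coe_nndist, Prod.dist_eq,
      lt_max_iff, Real.dist_eq, Real.dist_eq] at this
    rcases this with h' | h'
    · linarith [hg.2]
    · linarith [hg.2]
  have key' : ∀ᶠ g : ℝ in 𝓝[>] 0, ∀ i j, i ≠ j →
      ∀ x ∈ Icc (S.a i) (S.a i + S.h i), ∀ x' ∈ Icc (S.a j) (S.a j + S.h j),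
      ∀ y ∈ Icc (S.d i) (S.d i + S.v i), ∀ y' ∈ Icc (S.d j) (S.d j + S.v j),
      |x - x'| < g → g ≤ |y - y'| := by
    rw [eventually_all]; intro i
    rw [eventually_all]; intro j
    by_cases hij : i = j
    · exact Eventually.of_forall fun g h => (h hij).elim
    · exact (key i j hij).mono fun g hg _ => hg
  obtain ⟨g, hg, hg'⟩ := (key'.and self_mem_nhdsWithin).exists
  exact ⟨g, hg', hg⟩

/-- Uniform bounds on the contraction ratios. -/
lemma exists_ratio_bounds : ∃ κ ρ : ℝ, 0 < κ ∧ κ < 1 ∧ 0 < ρ ∧ ρ < 1 ∧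
    (∀ i, κ ≤ S.h i ∧ κ ≤ S.v i) ∧ ∀ i, S.h i ≤ ρ ∧ S.v i ≤ ρ := by
  have h1 : ∀ᶠ κ : ℝ in 𝓝[>] 0, ∀ i, κ ≤ S.h i ∧ κ ≤ S.v i := by
    rw [eventually_all]; intro i
    filter_upwards [Ioo_mem_nhdsGT (S.h_pos i), Ioo_mem_nhdsGT (S.v_pos i)] with κ h h'
    exact ⟨h.2.le, h'.2.le⟩
  have h2 : ∀ᶠ ρ : ℝ in 𝓝[<] 1, ∀ i, S.h i ≤ ρ ∧ S.v i ≤ ρ := by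
    rw [eventually_all]; intro i
    filter_upwards [Ioo_mem_nhdsLT (S.h_lt_one i), Ioo_mem_nhdsLT (S.v_lt_one i)] with κ h h'
    exact ⟨h.1.le, h'.1.le⟩
  obtain ⟨κ, hκ, hκ'⟩ := (h1.and (Ioo_mem_nhdsGT one_pos)).exists
  obtain ⟨ρ, hρ, hρ'⟩ := (h2.and (Ioo_mem_nhdsLT one_pos)).exists
  exact ⟨κ, ρ, hκ'.1, hκ'.2, hρ'.1, hρ'.2, hκ, hρ⟩

lemma width_le_one (u : List (Fin m)) : S.width u ≤ 1 := by
  induction u with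
  | nil => simp
  | cons i u ih =>
    rw [width_cons]
    exact mul_le_one₀ (S.h_lt_one i).le (S.width_pos u).le ih

lemma height_le_one (u : List (Fin m)) : S.height u ≤ 1 := by
  induction u with
  | nil => simp
  | cons i u ih =>
    rw [height_cons]
    exact mul_le_one₀ (S.v_lt_one i).le (S.height_pos u).le ih

lemma height_le_pow {ρ : ℝ} (hρ : ∀ i, S.h i ≤ ρ ∧ S.v i ≤ ρ) (u : List (Fin m)) :
    S.height u ≤ ρ ^ u.length := by
  induction u with
  | nil => simp
  | cons i u ih =>
    rw [height_cons, List.length_cons, pow_succ']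
    exact mul_le_mul (hρ i).2 ih (S.height_pos u).le ((S.v_pos i).le.trans (hρ i).2)

lemma width_le_pow {ρ : ℝ} (hρ : ∀ i, S.h i ≤ ρ ∧ S.v i ≤ ρ) (u : List (Fin m)) :
    S.width u ≤ ρ ^ u.length := by
  induction u with
  | nil => simp
  | cons i u ih =>
    rw [width_cons, List.length_cons, pow_succ']
    exact mul_le_mul (hρ i).1 ih (S.width_pos u).le ((S.h_pos i).le.trans (hρ i).1)

variable {S} {E : Set Plane}

lemma map_mem_attractor (hE : IsSelfAffineSet S.map E) (i : Fin m) {z : Plane} (hz : z ∈ E) :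
    S.map i z ∈ E := by
  rw [hE.2.2]
  exact mem_iUnion.2 ⟨i, z, hz, rfl⟩

lemma exists_map_eq (hE : IsSelfAffineSet S.map E) {z : Plane} (hz : z ∈ E) :
    ∃ i, ∃ q ∈ E, S.map i q = z := by
  rw [hE.2.2] at hz
  obtain ⟨i, q, hq, h⟩ := mem_iUnion.1 hz
  exact ⟨i, q, hq, h⟩

lemma wordMap_mem_attractor (hE : IsSelfAffineSet S.map E) (u : List (Fin m)) {z : Plane}
    (hz : z ∈ E) : S.wordMap u z ∈ E := by
  induction u with
  | nil => exact hz
  | cons i u ih => exact map_mem_attractor hE i ih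

/-- A continuous function `φ` with `φ (map i z) < φ z` wherever `φ (map i z)` is positive is
nonpositive on the attractor, as one sees at a maximum point. -/
lemma le_of_contracting (hE : IsSelfAffineSet S.map E) {φ : Plane → ℝ} (hφ : Continuous φ)
    (h : ∀ i z, 0 < φ (S.map i z) → φ (S.map i z) < φ z) : ∀ z ∈ E, φ z ≤ 0 := by
  obtain ⟨y, hy, hmax⟩ := hE.1.exists_isMaxOn hE.2.1 hφ.continuousOn
  intro z hz
  by_contra! hpos
  obtain ⟨i, q, hq, rfl⟩ := exists_map_eq hE hy
  have h1 := h i q (hpos.trans_le (hmax hz))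
  have h2 : φ q ≤ _ := hmax hq
  linarith

lemma subset_unitSquare (hE : IsSelfAffineSet S.map E) : E ⊆ unitSquare := by
  have key : ∀ {r s t : ℝ}, 0 < r → r < 1 → s ≤ 0 → 0 < r * t + s → r * t + s < t := by
    intro r s t hr hr' hs h
    have : 0 < r * t := by linarith
    have : 0 < t := by nlinarith
    nlinarith
  intro z hz
  have h0 := fun i => S.h_pos i; have h0' := fun i => S.h_lt_one i
  have h1 := fun i => S.v_pos i; have h1' := fun i => S.v_lt_one i
  have ha := S.a_nonneg; have ha' := S.a_add_h_le; have hd := S.d_nonneg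
  have hd' := S.d_add_v_le
  refine ⟨⟨?_, ?_⟩, ?_, ?_⟩
  · have := le_of_contracting hE (φ := fun z => - z 0) (by fun_prop) (fun i z hi => ?_) z hz
    · simpa using this
    · simp only [map_fst] at hi ⊢
      linarith [key (h0 i) (h0' i) (neg_nonpos.2 (ha i)) (t := - z 0) (by linarith)]
  · have := le_of_contracting hE (φ := fun z => z 0 - 1) (by fun_prop) (fun i z hi => ?_) z hz
    · simpa using this
    · simp only [map_fst] at hi ⊢
      linarith [key (h0 i) (h0' i) (s := S.a i + S.h i - 1) (by linarith [ha' i])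
        (t := z 0 - 1) (by linarith)]
  · have := le_of_contracting hE (φ := fun z => - z 1) (by fun_prop) (fun i z hi => ?_) z hz
    · simpa using this
    · simp only [map_snd] at hi ⊢
      linarith [key (h1 i) (h1' i) (neg_nonpos.2 (hd i)) (t := - z 1) (by linarith)]
  · have := le_of_contracting hE (φ := fun z => z 1 - 1) (by fun_prop) (fun i z hi => ?_) z hz
    · simpa using this
    · simp only [map_snd] at hi ⊢
      linarith [key (h1 i) (h1' i) (s := S.d i + S.v i - 1) (by linarith [hd' i])
        (t := z 1 - 1) (by linarith)]

/-- Each vertical line over `[0,1]` meets the carpet: the projections of the maps cover `[0,1]`. -/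
lemma exists_mem_fst_eq (hE : IsSelfAffineSet S.map E) {c : ℝ} (hc : c ∈ Icc (0 : ℝ) 1) :
    ∃ z ∈ E, z 0 = c := by
  obtain ⟨κ, ρ, -, -, hρ0, hρ1, -, hρ⟩ := S.exists_ratio_bounds
  have happrox : ∀ n : ℕ, ∀ c ∈ Icc (0 : ℝ) 1, ∃ z ∈ E, |z 0 - c| ≤ ρ ^ n := by
    intro n
    induction n with
    | zero =>
      intro c hc
      obtain ⟨z, hz⟩ := hE.2.1
      obtain ⟨⟨h0, h0'⟩, -⟩ := subset_unitSquare hE hz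
      refine ⟨z, hz, ?_⟩
      rw [pow_zero, abs_le]
      constructor <;> linarith [hc.1, hc.2]
    | succ n ih =>
      intro c hc
      obtain ⟨i, -, -, hi, -⟩ := S.cover c hc
      have hh := S.h_pos i
      obtain ⟨z, hz, hzc⟩ := ih ((c - S.a i) / S.h i)
        ⟨div_nonneg (by linarith [hi.1]) hh.le, (div_le_one hh).2 (by linarith [hi.2])⟩
      refine ⟨S.map i z, map_mem_attractor hE i hz, ?_⟩
      have : S.map i z 0 - c = S.h i * (z 0 - (c - S.a i) / S.h i) := by
        rw [map_fst]; field_simp; ring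
      rw [this, abs_mul, abs_of_pos hh, pow_succ']
      exact mul_le_mul (hρ i).1 hzc (abs_nonneg _) hρ0.le
  have hcl : IsClosed ((fun z : Plane => z 0) '' E) :=
    (hE.1.image (by fun_prop)).isClosed
  have : c ∈ (fun z : Plane => z 0) '' E := by
    rw [← hcl.closure_eq, Metric.mem_closure_iff]
    intro ε hε
    obtain ⟨n, hn⟩ := exists_pow_lt_of_lt_one hε hρ1
    obtain ⟨z, hz, hzc⟩ := happrox n c hc
    refine ⟨z 0, ⟨z, hz, rfl⟩, ?_⟩
    rw [dist_comm, Real.dist_eq]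
    linarith
  exact this

lemma exists_word_length_eq (hE : IsSelfAffineSet S.map E) (n : ℕ) {z : Plane} (hz : z ∈ E) :
    ∃ u : List (Fin m), u.length = n ∧ ∃ q ∈ E, S.wordMap u q = z := by
  induction n generalizing z with
  | zero => exact ⟨[], rfl, z, hz, rfl⟩
  | succ n ih =>
    obtain ⟨i, q, hq, rfl⟩ := exists_map_eq hE hz
    obtain ⟨u, hu, q', hq', rfl⟩ := ih hq
    exact ⟨i :: u, by simp [hu], q', hq', rfl⟩

/-- Each point of the carpet lies in a cylinder whose height is comparable to a given `r ≤ 1`. -/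
lemma exists_word_height (hE : IsSelfAffineSet S.map E) {κ : ℝ}
    (hκ : ∀ i, κ ≤ S.h i ∧ κ ≤ S.v i) (hκ1 : κ ≤ 1) {z : Plane} (hz : z ∈ E) {r : ℝ} (hr : 0 < r)
    (hr1 : r ≤ 1) :
    ∃ u : List (Fin m), κ * r ≤ S.height u ∧ S.height u ≤ r ∧ ∃ q ∈ E, S.wordMap u q = z := by
  obtain ⟨-, ρ, -, -, hρ0, hρ1, -, hρ⟩ := S.exists_ratio_bounds
  obtain ⟨n, hn⟩ := exists_pow_lt_of_lt_one hr hρ1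
  replace hn := hn.le
  induction n generalizing z r with
  | zero =>
    have : r = 1 := le_antisymm hr1 (by simpa using hn)
    exact ⟨[], by simpa [this] using hκ1, by simp [this], z, hz, rfl⟩
  | succ n ih =>
    obtain ⟨i, q, hq, rfl⟩ := exists_map_eq hE hz
    have hv := S.v_pos i
    by_cases hi : S.v i ≤ r
    · exact ⟨[i], by simpa using by nlinarith [(hκ i).2], by simpa using hi, q, hq, rfl⟩
    · push Not at hi
      obtain ⟨u, hu, hu', q', hq', rfl⟩ := ih hq (div_pos hr hv) ((div_le_one hv).2 hi.le) (by
        rw [le_div_iff₀ hv]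
        calc ρ ^ n * S.v i ≤ ρ ^ n * ρ := by gcongr; exact (hρ i).2
          _ ≤ r := by rwa [← pow_succ])
      refine ⟨i :: u, ?_, ?_, q', hq', rfl⟩
      · calc κ * r = S.v i * (κ * (r / S.v i)) := by field_simp
          _ ≤ _ := by rw [height_cons]; gcongr
      · calc S.height (i :: u) ≤ S.v i * (r / S.v i) := by rw [height_cons]; gcongr
          _ = r := by field_simp

/-- A cylinder rectangle contains no points of the carpet apart from the cylinder. -/
lemma mem_of_wordMap_mem (hE : IsSelfAffineSet S.map E) (u : List (Fin m)) {q : Plane}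
    (hq : q ∈ unitSquare) (h : S.wordMap u q ∈ E) : q ∈ E := by
  induction u with
  | nil => exact h
  | cons i u ih =>
    obtain ⟨j, e, he, hje⟩ := exists_map_eq hE h
    obtain ⟨-, h2⟩ := S.eq_of_map_eq (subset_unitSquare hE he) (S.wordMap_mapsTo u hq) hje
    exact ih (h2 ▸ he)

/-- Points of the carpet which are close to a point of a cylinder, by comparison with the width and
the height of its rectangle, lie in the cylinder. -/
lemma mem_cylinder_of_close (hE : IsSelfAffineSet S.map E) {g : ℝ} (hg : S.IsGap g)
    (u : List (Fin m)) {q y : Plane}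
    (hq : q ∈ unitSquare) (hy : y ∈ E) (h0 : |y 0 - S.wordMap u q 0| < g * S.width u)
    (h1 : |y 1 - S.wordMap u q 1| < g * S.height u) : ∃ y' ∈ E, S.wordMap u y' = y := by
  induction u generalizing y with
  | nil => exact ⟨y, hy, rfl⟩
  | cons i u ih =>
    obtain ⟨j, e, he, rfl⟩ := exists_map_eq hE hy
    have hm := S.map_mem i (S.wordMap_mapsTo u hq)
    have hm' := S.map_mem j (subset_unitSquare hE he)
    have hji : j = i := by
      by_contra hji
      have := hg.2 j i hji _ hm'.1 _ hm.1 _ hm'.2 _ hm.2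
        (h0.trans_le (mul_le_of_le_one_right hg.1.le (S.width_le_one _)))
      have h2 := mul_le_of_le_one_right hg.1.le (S.height_le_one (i :: u))
      rw [wordMap_cons] at h1
      exact absurd this (not_le.2 (h1.trans_le h2))
    subst hji
    have hp := S.h_pos j; have hp' := S.v_pos j
    obtain ⟨y', hy', rfl⟩ := ih he
      (by
        rw [wordMap_cons, map_fst, map_fst, width_cons, add_sub_add_right_eq_sub, ← mul_sub,
          abs_mul, abs_of_pos hp] at h0
        nlinarith)
      (by
        rw [wordMap_cons, map_snd, map_snd, height_cons, add_sub_add_right_eq_sub, ← mul_sub,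
          abs_mul, abs_of_pos hp'] at h1
        nlinarith)
    exact ⟨y', hy', rfl⟩

end Carpet
end SelfAffine

/-! ### Slices of the carpet and horizontally fibred points -/

namespace SelfAffine

/-- The vertical slice of a planar set over the abscissa `c`. -/
def slice (E : Set Plane) (c : ℝ) : Set ℝ := {y | !₂[c, y] ∈ E}

lemma snd_mem_slice {E : Set Plane} {z : Plane} (hz : z ∈ E) : z 1 ∈ slice E (z 0) := by
  have : (!₂[z 0, z 1] : Plane) = z := plane_ext (by simp) (by simp)
  rwa [slice, mem_ofPred_eq, this]

lemma snd_mem_slice' {E : Set Plane} {z : Plane} {c : ℝ} (hz : z ∈ E) (hc : z 0 = c) :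
    z 1 ∈ slice E c := hc ▸ snd_mem_slice hz

lemma isClosed_slice {E : Set Plane} (hE : IsClosed E) (c : ℝ) : IsClosed (slice E c) :=
  hE.preimage (f := fun y : ℝ => (!₂[c, y] : Plane)) (by fun_prop)

/-- Quantitative absence of isolated points, at the scales `r ≤ 1`: around each point of `K` the
annulus with radii `β * r` and `r` meets `K`. -/
def UniformlyPerfect (β : ℝ) (K : Set ℝ) : Prop :=
  ∀ y ∈ K, ∀ r, 0 < r → r ≤ 1 → ∃ y' ∈ K, β * r ≤ |y' - y| ∧ |y' - y| ≤ r

/-- A form of porosity, at the scales `r ≤ 1`, that is stable under finite unions: each interval of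
radius `r`, centred at `K` or not, contains an interval of radius `α * r` disjoint from `K`. -/
def HasHoles (α : ℝ) (K : Set ℝ) : Prop :=
  ∀ y r, 0 < r → r ≤ 1 → ∃ y', |y' - y| + α * r ≤ r ∧ ∀ k ∈ K, α * r < |k - y'|

/-- To have holes in all intervals it suffices to have them in the intervals centred at `K`. -/
lemma HasHoles.of_centred {α : ℝ} {K : Set ℝ} (hα1 : α ≤ 1)
    (h : ∀ y ∈ K, ∀ r, 0 < r → r ≤ 1 →
      ∃ y', |y' - y| + α * r ≤ r ∧ ∀ k ∈ K, α * r < |k - y'|) : HasHoles (α / 2) K := by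
  intro y r hr hr1
  by_cases hy : ∃ k ∈ K, |k - y| ≤ r / 2
  · obtain ⟨k, hk, hky⟩ := hy
    obtain ⟨y', hy', hole⟩ := h k hk (r / 2) (by positivity) (by linarith)
    refine ⟨y', ?_, fun k hk => by linarith [hole k hk]⟩
    linarith [abs_sub_le y' k y]
  · push Not at hy
    refine ⟨y, by rw [sub_self, abs_zero]; nlinarith, fun k hk => ?_⟩
    nlinarith [hy k hk]

/-- At small scales around `x` the set `E` looks like a union of horizontal segments: each point of
`E` in the ball `B(x, t)` may be moved horizontally within the vertical strip of width `2 * t`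
around `x`, at the cost of a vertical error that is small compared with `t`. -/
def HorizontallyFibred (E : Set Plane) (x : Plane) : Prop :=
  ∀ δ > 0, ∀ᶠ t in 𝓝[>] (0 : ℝ), ∀ y ∈ E, dist y x ≤ t → ∀ s, |s| ≤ t →
    ∃ y' ∈ E, y' 0 = x 0 + s ∧ |y' 1 - y 1| ≤ δ * t

namespace Carpet

variable {m : ℕ} {S : Carpet m} {E : Set Plane}

lemma exists_mem_map_fst_eq (hE : IsSelfAffineSet S.map E) {c : ℝ} {i : Fin m}
    (hc : c ∈ Icc (S.a i) (S.a i + S.h i)) : ∃ q ∈ E, S.map i q 0 = c := by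
  have hh := S.h_pos i
  obtain ⟨q, hq, hqc⟩ := exists_mem_fst_eq hE (c := (c - S.a i) / S.h i)
    ⟨div_nonneg (by linarith [hc.1]) hh.le, (div_le_one hh).2 (by linarith [hc.2])⟩
  exact ⟨q, hq, by rw [map_fst, hqc]; field_simp; ring⟩

/-- Slices are uniformly perfect: a cylinder of height about `r` contains two subcylinders which
meet the same vertical line at a vertical distance comparable to `r`. -/
lemma exists_uniformlyPerfect_slice (hE : IsSelfAffineSet S.map E) :
    ∃ β > 0, ∀ c, UniformlyPerfect β (slice E c) := by
  obtain ⟨κ, -, hκ0, hκ1, -, -, hκ, -⟩ := S.exists_ratio_bounds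
  obtain ⟨g, hg0, hg⟩ := S.exists_isGap
  refine ⟨κ * (g / 2), by positivity, fun c y hy r hr hr1 => ?_⟩
  obtain ⟨u, hu, hu', q, hq, hqz⟩ := exists_word_height hE hκ hκ1.le hy hr hr1
  have hq0 : S.wordMap u q 0 = c := by rw [hqz]; simp
  have hq1 : S.wordMap u q 1 = y := by rw [hqz]; simp
  obtain ⟨i, j, hij, hi, hj⟩ := S.cover (q 0) (subset_unitSquare hE hq).1
  obtain ⟨zi, hzi, hzi0⟩ := exists_mem_map_fst_eq hE hi
  obtain ⟨zj, hzj, hzj0⟩ := exists_mem_map_fst_eq hE hj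
  have hmi := S.map_mem i (subset_unitSquare hE hzi)
  have hmj := S.map_mem j (subset_unitSquare hE hzj)
  have hsep := hg i j hij _ hmi.1 _ hmj.1 _ hmi.2 _ hmj.2 (by simpa [hzi0, hzj0] using hg0)
  have key : ∃ z ∈ E, z 0 = q 0 ∧ g / 2 ≤ |z 1 - q 1| := by
    by_contra! hcon
    have h1 := hcon _ (map_mem_attractor hE i hzi) hzi0
    have h2 := hcon _ (map_mem_attractor hE j hzj) hzj0
    have h3 := abs_sub_le (S.map i zi 1) (q 1) (S.map j zj 1)
    rw [abs_sub_comm (q 1)] at h3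
    linarith
  obtain ⟨z, hz, hz0, hz1⟩ := key
  have hd : S.wordMap u z 1 - y = S.height u * (z 1 - q 1) := by
    rw [← hq1, wordMap_snd_sub]
  refine ⟨S.wordMap u z 1, snd_mem_slice' (wordMap_mem_attractor hE u hz) ?_, ?_⟩
  · rw [← hq0, ← sub_eq_zero, wordMap_fst_sub, hz0, sub_self, mul_zero]
  · rw [hd, abs_mul, abs_of_pos (S.height_pos u)]
    have hz' := (subset_unitSquare hE hz).2
    have hq' := (subset_unitSquare hE hq).2
    have h1 : |z 1 - q 1| ≤ 1 := by
      rw [abs_le]; constructor <;> linarith [hz'.1, hz'.2, hq'.1, hq'.2]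
    constructor
    · calc κ * (g / 2) * r = (κ * r) * (g / 2) := by ring
        _ ≤ _ := mul_le_mul hu hz1 (by positivity) (S.height_pos u).le
    · calc S.height u * |z 1 - q 1| ≤ r * 1 := by gcongr
        _ = r := mul_one r

/-- On a vertical line the lowest rectangle of the first generation is followed by a hole. -/
lemma exists_hole_first_generation (hE : IsSelfAffineSet S.map E) {g : ℝ} (hg : S.IsGap g) {c : ℝ}
    (hc : c ∈ Icc (0 : ℝ) 1) : ∃ η, g / 2 ≤ η ∧ η ≤ 1 - g / 2 ∧
      ∀ z ∈ E, z 0 = c → g / 2 ≤ |z 1 - η| := by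
  classical
  obtain ⟨i₁, i₂, hi, hi₁, hi₂⟩ := S.cover c hc
  obtain ⟨i, hiI, himin⟩ := (Finset.univ.filter fun i =>
    c ∈ Icc (S.a i) (S.a i + S.h i)).exists_min_image S.d ⟨i₁, by simpa using hi₁⟩
  replace hiI : c ∈ Icc (S.a i) (S.a i + S.h i) := (Finset.mem_filter.1 hiI).2
  have hv := fun k => S.v_pos k
  -- the other rectangles over `c` lie higher by at least `g`
  have habove : ∀ j, j ≠ i → c ∈ Icc (S.a j) (S.a j + S.h j) → S.d i + S.v i + g ≤ S.d j := by
    intro j hji hj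
    have hdj : S.d i ≤ S.d j := himin j (Finset.mem_filter.2 ⟨Finset.mem_univ _, hj⟩)
    have htop : S.d i + S.v i < S.d j := by
      by_contra! hcon
      exact Set.disjoint_left.1 (S.disjoint j i hji)
        (show (c, S.d j) ∈ _ from ⟨hj, le_rfl, by linarith [hv j]⟩) ⟨hiI, hdj, hcon⟩
    have := hg.2 j i hji c hj c hiI (S.d j) ⟨le_rfl, by linarith [hv j]⟩ (S.d i + S.v i)
      ⟨by linarith [hv i], le_rfl⟩ (by simpa using hg.1)
    rw [abs_of_pos (by linarith)] at this
    linarith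
  obtain ⟨j, hji, hj⟩ : ∃ j, j ≠ i ∧ c ∈ Icc (S.a j) (S.a j + S.h j) := by
    by_cases h : i₁ = i
    · exact ⟨i₂, fun h' => hi (h.trans h'.symm), hi₂⟩
    · exact ⟨i₁, h, hi₁⟩
  have hg0 := hg.1
  refine ⟨S.d i + S.v i + g / 2, ?_, ?_, ?_⟩
  · linarith [S.d_nonneg i, hv i]
  · linarith [habove j hji hj, S.d_add_v_le j, hv j]
  · intro z hz hzc
    obtain ⟨k, q, hq, rfl⟩ := exists_map_eq hE hz
    have hk := S.map_mem k (subset_unitSquare hE hq)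
    rw [hzc] at hk
    by_cases hki : k = i
    · subst hki
      exact (by linarith [hk.2.2] : g / 2 ≤ -(S.map k q 1 - (S.d k + S.v k + g / 2))).trans
        (neg_le_abs _)
    · exact (by linarith [hk.2.1, habove k hki hk.1] :
        g / 2 ≤ S.map k q 1 - (S.d i + S.v i + g / 2)).trans (le_abs_self _)

/-- Slices are porous, with constants that do not depend on the slice. -/
lemma exists_hasHoles_slice (hE : IsSelfAffineSet S.map E) :
    ∃ α > 0, α ≤ 1 ∧ ∀ c, HasHoles α (slice E c) := by
  obtain ⟨κ, -, hκ0, hκ1, -, -, hκ, -⟩ := S.exists_ratio_bounds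
  obtain ⟨g, hg⟩ := S.exists_isGap
  have hg0 := hg.1
  have hg1 : g ≤ 1 := by
    obtain ⟨η, h1, h2, -⟩ := exists_hole_first_generation hE hg (c := 0) (by simp)
    linarith
  have hα1 : κ * (g / 4) ≤ 1 := by nlinarith
  refine ⟨κ * (g / 4) / 2, by positivity, by linarith,
    fun c => HasHoles.of_centred hα1 fun y hy r hr hr1 => ?_⟩
  obtain ⟨u, hu, hu', q, hq, hqz⟩ := exists_word_height hE hκ hκ1.le hy hr hr1
  have hq0 : S.wordMap u q 0 = c := by rw [hqz]; simp
  have hq1 : S.wordMap u q 1 = y := by rw [hqz]; simp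
  have hqQ := subset_unitSquare hE hq
  obtain ⟨η, hη0, hη1, hη⟩ := exists_hole_first_generation hE hg hqQ.1
  have hH := S.height_pos u
  set p : Plane := !₂[q 0, η] with hp
  have hp1 : p 1 = η := by simp [hp]
  refine ⟨S.wordMap u p 1, ?_, fun k hk => ?_⟩
  · rw [← hq1, wordMap_snd_sub, hp1, abs_mul, abs_of_pos hH]
    have : |η - q 1| ≤ 1 - g / 2 := by
      rw [abs_le]; constructor <;> linarith [hqQ.2.1, hqQ.2.2]
    have h1 : S.height u * |η - q 1| ≤ r * (1 - g / 2) := by gcongr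
    nlinarith [mul_pos hg0 hr]
  · have hlt : κ * (g / 4) * r < S.height u * (g / 2) := by
      have : κ * r * (g / 2) ≤ S.height u * (g / 2) := by gcongr
      nlinarith [mul_pos (mul_pos hκ0 hr) hg0]
    refine hlt.trans_le ?_
    -- the point of the carpet lies in the rectangle of `u`, or below it, or above it
    set e : Plane := !₂[q 0, (k - S.wordMap u 0 1) / S.height u] with he
    have hke : S.wordMap u e = !₂[c, k] := by
      refine plane_ext ?_ ?_
      · rw [← sub_eq_zero, ← hq0]
        simp [wordMap_fst_sub, he]
      · rw [wordMap_snd]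
        simp [he]
        field_simp
        ring
    have hke1 : k = S.wordMap u e 1 := by rw [hke]; simp
    rw [hke1, wordMap_snd_sub, hp1, abs_mul, abs_of_pos hH]
    gcongr
    by_cases heQ : e 1 ∈ Icc (0 : ℝ) 1
    · have he0 : e 0 = q 0 := by simp [he]
      refine hη e (mem_of_wordMap_mem hE u ⟨by rw [he0]; exact hqQ.1, heQ⟩ ?_) he0
      rw [hke]; exact hk
    · rw [mem_Icc, not_and_or, not_le, not_le] at heQ
      rcases heQ with h | h
      · exact (by linarith : g / 2 ≤ -(e 1 - η)).trans (neg_le_abs _)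
      · exact (by linarith : g / 2 ≤ e 1 - η).trans (le_abs_self _)

/-- A point of a cylinder can be moved within the cylinder to each abscissa that no end point of
the horizontal projection of the cylinder separates from it. -/
lemma exists_mem_cylinder_fst_eq (hE : IsSelfAffineSet S.map E) (u : List (Fin m)) {q : Plane}
    (hq : q ∈ E) {c ε x : ℝ} (hqc : |S.wordMap u q 0 - c| ≤ ε) (hx : |x - c| ≤ ε)
    (h0 : ε < |c - S.wordMap u 0 0|) (h1 : ε < |c - (S.wordMap u 0 0 + S.width u)|) :
    ∃ q' ∈ E, S.wordMap u q' 0 = x := by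
  have hW := S.width_pos u
  have hq0 := (subset_unitSquare hE hq).1
  rw [wordMap_fst, abs_le] at hqc
  rw [abs_le] at hx
  have h2 : 0 ≤ S.width u * q 0 := mul_nonneg hW.le hq0.1
  have h3 : S.width u * q 0 ≤ S.width u := mul_le_of_le_one_right hW.le hq0.2
  have h4 : S.wordMap u 0 0 ≤ x := by
    rcases lt_abs.1 h0 with h | h <;> linarith
  have h5 : x ≤ S.wordMap u 0 0 + S.width u := by
    rcases lt_abs.1 h1 with h | h <;> linarith
  obtain ⟨q', hq', hq'x⟩ := exists_mem_fst_eq hE (c := (x - S.wordMap u 0 0) / S.width u)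
    ⟨div_nonneg (by linarith) hW.le, (div_le_one hW).2 (by linarith)⟩
  refine ⟨q', hq', ?_⟩
  rw [wordMap_fst, hq'x]
  field_simp
  ring

/-- A point `x` of the carpet is horizontally fibred as soon as the horizontal positions of `x` in
the cylinders around it stay away from each given end point of a cylinder by more than the ratio
of height to width, which is the width of a square as high as the cylinder after rescaling the
cylinder to the unit square. -/
lemma horizontallyFibred_of_generic (hE : IsSelfAffineSet S.map E) {x : Plane}
    (U : ℕ → List (Fin m)) (X : ℕ → Plane) (hXE : ∀ n, X n ∈ E)
    (hX : ∀ n, S.wordMap (U n) (X n) = x) {κ : ℝ} (hκ0 : 0 < κ)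
    (hU : ∀ n, κ * S.height (U n) ≤ S.height (U (n + 1)))
    (hlim : Tendsto (fun n => S.height (U n)) atTop (𝓝 0))
    (hgen : ∀ u : List (Fin m), ∀ᶠ n in atTop,
      S.height (U n) / S.width (U n) < |X n 0 - S.wordMap u 0 0| ∧
      S.height (U n) / S.width (U n) < |X n 0 - (S.wordMap u 0 0 + S.width u)|) :
    HorizontallyFibred E x := by
  obtain ⟨g, hg⟩ := S.exists_isGap
  have hg0 := hg.1
  have hg1 : g ≤ 1 := by
    obtain ⟨η, h1, h2, -⟩ := exists_hole_first_generation hE hg (c := 0) (by simp)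
    linarith
  obtain ⟨-, ρ, -, -, hρ0, hρ1, -, hρ⟩ := S.exists_ratio_bounds
  intro δ hδ
  obtain ⟨L, hL⟩ := exists_pow_lt_of_lt_one (show 0 < δ * g * κ by positivity) hρ1
  have hfin : {u : List (Fin m) | u.length = L}.Finite := List.finite_length_eq _ L
  obtain ⟨N, hN⟩ := eventually_atTop.1
    (((eventually_all_finite hfin).2 fun u _ => hgen u).and (hgen []))
  have hsmall : ∀ᶠ t in 𝓝[>] (0 : ℝ), ∀ k ∈ Finset.range (N + 1), t < g * S.height (U k) :=
    (Filter.eventually_all_finset _).2 fun k _ => eventually_nhdsWithin_of_eventually_nhds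
      (eventually_lt_nhds (mul_pos hg0 (S.height_pos _)))
  filter_upwards [hsmall, self_mem_nhdsWithin] with t ht ht0 y hy hyx s hs
  replace ht0 : 0 < t := ht0
  -- `n` is the last generation in which the height of the cylinder is larger than `t / g`
  obtain ⟨n, hnN, hn, hn'⟩ :
      ∃ n, N ≤ n ∧ t < g * S.height (U n) ∧ g * S.height (U (n + 1)) ≤ t := by
    classical
    have hex : ∃ k, g * S.height (U k) ≤ t := by
      obtain ⟨k, hk⟩ := (hlim.eventually_lt_const (div_pos ht0 hg0)).exists
      exact ⟨k, by rw [lt_div_iff₀ hg0] at hk; linarith⟩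
    have hNlt : N < Nat.find hex := by
      by_contra! hcon
      exact absurd (Nat.find_spec hex)
        (not_le.2 (ht _ (Finset.mem_range.2 (Nat.lt_succ_of_le hcon))))
    obtain ⟨n, hn⟩ := Nat.exists_eq_succ_of_ne_zero (Nat.ne_zero_of_lt hNlt)
    refine ⟨n, by lia, not_le.1 (Nat.find_min hex (by lia)), ?_⟩
    have := Nat.find_spec hex
    rwa [hn] at this
  have hW := S.width_pos (U n)
  have hH := S.height_pos (U n)
  obtain ⟨hgenL, hgen0⟩ := hN n hnN
  have hXQ := subset_unitSquare hE (hXE n)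
  have hHW : S.height (U n) < S.width (U n) := by
    rw [← div_lt_one hW]
    refine hgen0.1.trans_le ?_
    simpa [abs_of_nonneg hXQ.1.1] using hXQ.1.2
  have hco : ∀ i, |y i - x i| ≤ t := fun i =>
    ((PiLp.norm_apply_le (y - x) i).trans_eq (dist_eq_norm y x).symm).trans hyx
  obtain ⟨q, hq, rfl⟩ := mem_cylinder_of_close hE hg (U n) hXQ hy
    (by rw [hX]; exact (hco 0).trans_lt (hn.trans (by gcongr)))
    (by rw [hX]; exact (hco 1).trans_lt hn)
  obtain ⟨u, hu, q, hq', rfl⟩ := exists_word_length_eq hE L hq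
  have hε : t ≤ S.height (U n) := hn.le.trans (mul_le_of_le_one_left hH.le hg1)
  obtain ⟨q', hq'E, hq'x⟩ := exists_mem_cylinder_fst_eq hE u hq' (c := X n 0)
    (x := X n 0 + s / S.width (U n)) (ε := S.height (U n) / S.width (U n))
    (by
      have := hco 0
      rw [← hX n, wordMap_fst_sub, abs_mul, abs_of_pos hW] at this
      rw [le_div_iff₀ hW]
      linarith)
    (by
      rw [add_sub_cancel_left, abs_div, abs_of_pos hW]
      gcongr
      exact hs.trans hε)
    (hgenL u hu).1 (hgenL u hu).2
  refine ⟨S.wordMap (U n) (S.wordMap u q'),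
    wordMap_mem_attractor hE _ (wordMap_mem_attractor hE _ hq'E), ?_, ?_⟩
  · have := S.wordMap_fst_sub (U n) (S.wordMap u q') (X n)
    rw [hX, hq'x, add_sub_cancel_left, mul_div_cancel₀ _ hW.ne'] at this
    linarith
  · have h1 : |q' 1 - q 1| ≤ 1 := by
      have h2 := (subset_unitSquare hE hq'E).2
      have h3 := (subset_unitSquare hE hq').2
      rw [abs_le]; constructor <;> linarith [h2.1, h2.2, h3.1, h3.2]
    have h4 : S.height u ≤ ρ ^ L := hu ▸ S.height_le_pow hρ u
    rw [wordMap_snd_sub, wordMap_snd_sub, abs_mul, abs_mul, abs_of_pos hH,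
      abs_of_pos (S.height_pos u)]
    calc S.height (U n) * (S.height u * |q' 1 - q 1|)
        ≤ S.height (U n) * (δ * g * κ * 1) := by
          gcongr
          exact h4.trans hL.le
      _ = δ * (g * (κ * S.height (U n))) := by ring
      _ ≤ δ * (g * S.height (U (n + 1))) := by gcongr; exact hU n
      _ ≤ δ * t := by gcongr

end Carpet
end SelfAffine

/-! ### Tangent sets at horizontally fibred points -/

namespace SelfAffine

lemma HasHoles.union {α α' : ℝ} {K K' : Set ℝ} (hα : 0 < α) (hα1 : α ≤ 1) (hK : HasHoles α K)
    (hK' : HasHoles α' K') : HasHoles (α * α') (K ∪ K') := by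
  intro y r hr hr1
  obtain ⟨y₁, h₁, hole₁⟩ := hK y r hr hr1
  obtain ⟨y₂, h₂, hole₂⟩ := hK' y₁ (α * r) (by positivity) (by nlinarith)
  refine ⟨y₂, by linarith [abs_sub_le y₂ y₁ y], ?_⟩
  rintro k (hk | hk)
  · linarith [hole₁ k hk, abs_sub_le k y₂ y₁]
  · linarith [hole₂ k hk]

lemma HasHoles.preimage {α s : ℝ} {K : Set ℝ} (hK : HasHoles α K) (hs : s ≠ 0) (hs1 : |s| ≤ 1)
    (b : ℝ) : HasHoles α {y | s * y + b ∈ K} := by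
  intro y r hr hr1
  have hs0 := abs_pos.2 hs
  obtain ⟨y', h, hole⟩ := hK (s * y + b) (|s| * r) (by positivity) (by nlinarith)
  refine ⟨(y' - b) / s, ?_, fun k hk => ?_⟩
  · have : y' - (s * y + b) = s * ((y' - b) / s - y) := by field_simp; ring
    rw [this, abs_mul] at h
    nlinarith
  · have h' := hole _ hk
    have : s * k + b - y' = s * (k - (y' - b) / s) := by field_simp; ring
    rw [this, abs_mul] at h'
    nlinarith

lemma UniformlyPerfect.preimage {β s : ℝ} {K : Set ℝ} (hK : UniformlyPerfect β K) (hs : s ≠ 0)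
    (hs1 : |s| ≤ 1) (b : ℝ) : UniformlyPerfect β {y | s * y + b ∈ K} := by
  intro y hy r hr hr1
  have hs0 := abs_pos.2 hs
  obtain ⟨y', hy', h, h'⟩ := hK _ hy (|s| * r) (by positivity) (by nlinarith)
  have heq : y' - (s * y + b) = s * ((y' - b) / s - y) := by field_simp; ring
  rw [heq, abs_mul] at h h'
  refine ⟨(y' - b) / s, ?_, ?_, ?_⟩
  · rwa [mem_ofPred_eq, mul_div_cancel₀ _ hs, sub_add_cancel]
  · nlinarith
  · nlinarith

lemma HasHoles.isPorous {α : ℝ} {K : Set ℝ} (hα : 0 < α) (hα1 : α ≤ 1) (hK : HasHoles α K)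
    (hK2 : K ⊆ Icc (-2) 2) : IsPorous K := by
  refine ⟨α / 4, by positivity, by linarith, fun x hx r hr hrd => ?_⟩
  have hd : Metric.ediam K ≤ ENNReal.ofReal 4 := by
    refine Metric.ediam_le fun y hy z hz => ?_
    rw [edist_dist, Real.dist_eq]
    refine ENNReal.ofReal_le_ofReal (abs_le.2 ⟨?_, ?_⟩) <;>
      linarith [(hK2 hy).1, (hK2 hy).2, (hK2 hz).1, (hK2 hz).2]
  have hr4 : r < 4 := (ENNReal.ofReal_lt_ofReal_iff (by norm_num)).1 (hrd.trans_le hd)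
  obtain ⟨y, hy, hole⟩ := hK x (r / 4) (by positivity) (by linarith)
  refine ⟨y, fun z hz => ?_⟩
  rw [Metric.mem_closedBall, Real.dist_eq] at hz
  refine ⟨?_, fun hzK => ?_⟩
  · rw [Metric.mem_closedBall, Real.dist_eq]
    linarith [abs_sub_le z y x]
  · linarith [hole z hzK]

lemma accPt_of_forall_exists {K : Set ℝ} {y : ℝ}
    (h : ∀ ε > 0, ∃ y' ∈ K, y' ≠ y ∧ |y' - y| ≤ ε) : AccPt y (𝓟 K) := by
  rw [accPt_iff_nhds]
  intro V hV
  obtain ⟨ε, hε, hεV⟩ := Metric.nhds_basis_closedBall.mem_iff.1 hV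
  obtain ⟨y', hy', hne, hle⟩ := h ε hε
  exact ⟨y', ⟨hεV (by rwa [Metric.mem_closedBall, Real.dist_eq]), hy'⟩, hne⟩

lemma UniformlyPerfect.accPt {β : ℝ} {K : Set ℝ} (hβ : 0 < β) (hK : UniformlyPerfect β K) {y : ℝ}
    (hy : y ∈ K) : AccPt y (𝓟 K) := by
  refine accPt_of_forall_exists fun ε hε => ?_
  obtain ⟨y', hy', h, h'⟩ := hK y hy (min ε 1) (by positivity) (min_le_right _ _)
  refine ⟨y', hy', ?_, h'.trans (min_le_left _ _)⟩
  rintro rfl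
  rw [sub_self, abs_zero] at h
  exact absurd h (not_le.2 (by positivity))

lemma norm_sq_plane (z : Plane) : ‖z‖ ^ 2 = z 0 ^ 2 + z 1 ^ 2 := by
  rw [EuclideanSpace.norm_sq_eq]
  simp [Fin.sum_univ_two]

lemma norm_le_abs_add_abs (z : Plane) : ‖z‖ ≤ |z 0| + |z 1| := by
  refine abs_le_of_sq_le_sq' ?_ (by positivity) |>.2
  rw [norm_sq_plane, ← sq_abs (z 0), ← sq_abs (z 1)]
  nlinarith [abs_nonneg (z 0), abs_nonneg (z 1)]

lemma abs_apply_le_norm (z : Plane) (i : Fin 2) : |z i| ≤ ‖z‖ := PiLp.norm_apply_le z i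

lemma mem_of_forall_close {T : Set Plane} (hT : IsClosed T) {p : Plane}
    (h : ∀ ε > 0, ∃ z ∈ T, |z 0 - p 0| ≤ ε ∧ |z 1 - p 1| ≤ ε) : p ∈ T := by
  rw [← hT.closure_eq, Metric.mem_closure_iff]
  intro ε hε
  obtain ⟨z, hz, h0, h1⟩ := h (ε / 4) (by positivity)
  refine ⟨z, hz, ?_⟩
  rw [dist_comm, dist_eq_norm]
  have := norm_le_abs_add_abs (z - p)
  simp only [PiLp.sub_apply] at this
  linarith

/-- The set `T` is, within the unit disc, the limit of the products `ℝ × W n`. The field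
`approximated` leaves a margin `ε` to the boundary of the disc, since points of the products near
the boundary need not be close to `T`. -/
structure IsLimitOfProducts (T : Set Plane) (W : ℕ → Set ℝ) : Prop where
  isClosed : IsClosed T
  subset_ball : T ⊆ Metric.closedBall 0 1
  approx : ∀ ε > 0, ∀ᶠ n in atTop, ∀ z ∈ T, ∃ η ∈ W n, |η - z 1| ≤ ε
  approximated : ∀ ε > 0, ∀ᶠ n in atTop, ∀ η ∈ W n, ∀ s, s ^ 2 + (|η| + ε) ^ 2 ≤ 1 →
    ∃ z ∈ T, |z 0 - s| ≤ ε ∧ |z 1 - η| ≤ ε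

namespace IsLimitOfProducts

variable {T : Set Plane} {W : ℕ → Set ℝ}

lemma mem_of_lt (hT : IsLimitOfProducts T W) {z : Plane} (hz : z ∈ T) {s : ℝ}
    (hs : s ^ 2 + z 1 ^ 2 < 1) : (!₂[s, z 1] : Plane) ∈ T := by
  refine mem_of_forall_close hT.isClosed fun ε hε => ?_
  have hcont : Continuous fun δ : ℝ => s ^ 2 + (|z 1| + 2 * δ) ^ 2 := by fun_prop
  have hev : ∀ᶠ δ in 𝓝[>] (0 : ℝ), s ^ 2 + (|z 1| + 2 * δ) ^ 2 < 1 :=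
    eventually_nhdsWithin_of_eventually_nhds
      (hcont.continuousAt.eventually_lt_const (by simpa using hs))
  obtain ⟨δ, hδ, hδ0, hδε⟩ :=
    (hev.and (Ioo_mem_nhdsGT (show (0 : ℝ) < ε / 2 by positivity))).exists
  obtain ⟨n, h1, h2⟩ := ((hT.approx δ hδ0).and (hT.approximated δ hδ0)).exists
  obtain ⟨η, hη, hηz⟩ := h1 z hz
  have hηabs : |η| + δ ≤ |z 1| + 2 * δ := by linarith [abs_sub_abs_le_abs_sub η (z 1)]
  obtain ⟨z', hz', h0', h1'⟩ := h2 η hη s (le_trans (by gcongr) hδ.le)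
  refine ⟨z', hz', by simpa using by linarith, ?_⟩
  have := abs_sub_le (z' 1) η (z 1)
  simp only [Matrix.cons_val_one, Matrix.cons_val_fin_one]
  linarith

lemma mem_of_le (hT : IsLimitOfProducts T W) {z : Plane} (hz : z ∈ T) (hz1 : |z 1| < 1) {s : ℝ}
    (hs : s ^ 2 + z 1 ^ 2 ≤ 1) : (!₂[s, z 1] : Plane) ∈ T := by
  refine mem_of_forall_close hT.isClosed fun ε hε => ?_
  have hz2 : z 1 ^ 2 < 1 := by rwa [sq_lt_one_iff_abs_lt_one]
  have hs1 : |s| ≤ 1 := by rw [← sq_le_one_iff_abs_le_one]; nlinarith [sq_nonneg (z 1)]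
  set l : ℝ := min ε (1 / 2)
  have hl0 : 0 < l := by positivity
  have hl1 : l ≤ 1 / 2 := min_le_right _ _
  refine ⟨_, hT.mem_of_lt hz (s := (1 - l) * s) ?_, ?_, by simp [hε.le]⟩
  · nlinarith [mul_pos (show 0 < 1 - (1 - l) ^ 2 by nlinarith) (sub_pos.2 hz2), sq_nonneg (1 - l)]
  · simp only [Matrix.cons_val_zero]
    rw [show (1 - l) * s - s = -(l * s) by ring, abs_neg, abs_mul, abs_of_pos hl0]
    calc l * |s| ≤ ε * 1 := by gcongr; exact min_le_left _ _
      _ = ε := mul_one ε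

lemma sq_add_sq_le (hT : IsLimitOfProducts T W) {z : Plane} (hz : z ∈ T) :
    z 0 ^ 2 + z 1 ^ 2 ≤ 1 := by
  have := hT.subset_ball hz
  rw [mem_closedBall_zero_iff] at this
  rw [← norm_sq_plane]
  nlinarith [norm_nonneg z]

lemma snd_mem_slice_zero (hT : IsLimitOfProducts T W) {z : Plane} (hz : z ∈ T) :
    z 1 ∈ slice T 0 := by
  have h := hT.sq_add_sq_le hz
  have hz1 : |z 1| ≤ 1 := by rw [← sq_le_one_iff_abs_le_one]; nlinarith [sq_nonneg (z 0)]
  rcases hz1.lt_or_eq with hlt | heq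
  · exact hT.mem_of_le hz hlt (by nlinarith [sq_nonneg (z 0)])
  · have : z 0 = 0 := by
      rw [← sq_eq_zero_iff]
      have : z 1 ^ 2 = 1 := by rw [← sq_abs, heq, one_pow]
      nlinarith [sq_nonneg (z 0)]
    exact snd_mem_slice' hz this

lemma slice_zero_subset (hT : IsLimitOfProducts T W) : slice T 0 ⊆ Icc (-1) 1 := by
  intro y hy
  have := hT.sq_add_sq_le hy
  rw [mem_Icc, ← abs_le, ← sq_le_one_iff_abs_le_one]
  simpa using this

/-- The limit is the part of a product `ℝ × C` in the unit disc, for each `C` with the right trace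
on `[-1, 1]`. -/
lemma eq_horizontalFibers (hT : IsLimitOfProducts T W) {C : Set ℝ}
    (hC : ∀ y ∈ Icc (-1 : ℝ) 1, y ∈ C ↔ y ∈ slice T 0) :
    T = horizontalFibers C ∩ Metric.closedBall 0 1 := by
  ext z
  constructor
  · intro hz
    have h := hT.snd_mem_slice_zero hz
    exact ⟨(hC _ (hT.slice_zero_subset h)).2 h, hT.subset_ball hz⟩
  · rintro ⟨hzC, hz⟩
    rw [mem_closedBall_zero_iff] at hz
    have hz1 : |z 1| ≤ 1 := (abs_apply_le_norm z 1).trans hz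
    have hs : z 0 ^ 2 + z 1 ^ 2 ≤ 1 := by rw [← norm_sq_plane]; nlinarith [norm_nonneg z]
    have hy : z 1 ∈ slice T 0 := (hC _ (abs_le.1 hz1)).1 hzC
    have hz' : (!₂[z 0, z 1] : Plane) = z := plane_ext (by simp) (by simp)
    rcases hz1.lt_or_eq with hlt | heq
    · have := hT.mem_of_le hy (by simpa using hlt) (s := z 0) (by simpa using hs)
      simpa [hz'] using this
    · have h0 : z 0 = 0 := by
        rw [← sq_eq_zero_iff]
        have : z 1 ^ 2 = 1 := by rw [← sq_abs, heq, one_pow]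
        nlinarith [sq_nonneg (z 0)]
      rw [← hz', h0]
      exact hy

lemma hasHoles_slice (hT : IsLimitOfProducts T W) {α : ℝ} (hα : 0 < α)
    (hW : ∀ᶠ n in atTop, HasHoles α (W n)) : HasHoles (α / 2) (slice T 0) := by
  intro y r hr hr1
  obtain ⟨n, hn, hn'⟩ := (hW.and (hT.approx (α * r / 4) (by positivity))).exists
  obtain ⟨y', hy', hole⟩ := hn y r hr hr1
  have hαr : 0 < α * r := by positivity
  refine ⟨y', by linarith, fun k hk => ?_⟩
  obtain ⟨η, hη, hηk⟩ := hn' _ hk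
  simp only [Matrix.cons_val_one, Matrix.cons_val_fin_one] at hηk
  linarith [hole η hη, abs_sub_le η k y']

/-- In the interior of the disc the central slice of the limit has no isolated points. -/
lemma accPt_slice (hT : IsLimitOfProducts T W) {β : ℝ} (hβ : 0 < β)
    (hW : ∀ᶠ n in atTop, UniformlyPerfect β (W n)) {y : ℝ} (hy : y ∈ slice T 0)
    (hy1 : |y| < 1) : AccPt y (𝓟 (slice T 0)) := by
  refine accPt_of_forall_exists fun ε hε => ?_
  obtain ⟨r, hr0, hr⟩ : ∃ r, 0 < r ∧ 2 * r ≤ ε ∧ |y| + 2 * r ≤ 1 ∧ r ≤ 1 := by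
    refine ⟨min (ε / 2) ((1 - |y|) / 2), lt_min (by positivity) (by linarith), ?_, ?_, ?_⟩
    · linarith [min_le_left (ε / 2) ((1 - |y|) / 2)]
    · linarith [min_le_right (ε / 2) ((1 - |y|) / 2)]
    · linarith [min_le_right (ε / 2) ((1 - |y|) / 2), abs_nonneg y]
  obtain ⟨δ, hδ0, hδβ, hδr⟩ : ∃ δ, 0 < δ ∧ 4 * δ ≤ β * r ∧ 4 * δ ≤ r :=
    ⟨min (β * r) r / 4, by positivity, by linarith [min_le_left (β * r) r],
      by linarith [min_le_right (β * r) r]⟩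
  obtain ⟨n, hn, hap, hap'⟩ :=
    (hW.and ((hT.approx δ hδ0).and (hT.approximated δ hδ0))).exists
  obtain ⟨η, hη, hηy⟩ := hap _ hy
  simp only [Matrix.cons_val_one, Matrix.cons_val_fin_one] at hηy
  obtain ⟨η', hη', hle, hle'⟩ := hn η hη r hr0 hr.2.2
  have hη'1 : |η'| + δ ≤ 1 := by
    linarith [abs_sub_abs_le_abs_sub η' y, abs_sub_le η' η y]
  obtain ⟨z, hz, -, hzη⟩ := hap' η' hη' 0 (by nlinarith [abs_nonneg η'])
  have h1 := abs_sub_le (z 1) η' y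
  have h2 := abs_sub_le η' η y
  refine ⟨z 1, hT.snd_mem_slice_zero hz, ?_, by linarith⟩
  intro h
  have h3 := abs_sub_le η' y η
  rw [abs_sub_comm η' y, abs_sub_comm y η] at h3
  have : 0 < β * r := by positivity
  rw [h] at hzη
  linarith

/-- The slice of the limit may have isolated points at the end points `±1` of its range. There a
copy of `K`, outside of the disc, is attached to it. -/
lemma exists_perfect_porous (hT : IsLimitOfProducts T W) {α β : ℝ} (hα : 0 < α) (hα1 : α ≤ 1)
    (hβ : 0 < β) (hWα : ∀ᶠ n in atTop, HasHoles α (W n))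
    (hWβ : ∀ᶠ n in atTop, UniformlyPerfect β (W n)) {K : Set ℝ} (hK : IsClosed K) (hK0 : 0 ∈ K)
    (hK1 : K ⊆ Icc 0 1) (hKα : HasHoles α K) (hKβ : UniformlyPerfect β K) :
    ∃ C : Set ℝ, Perfect C ∧ IsPorous C ∧ T = horizontalFibers C ∩ Metric.closedBall 0 1 := by
  set D := slice T 0 with hD
  set K₁ : Set ℝ := {y | 1 * y + (-1) ∈ K} with hK₁
  set K₂ : Set ℝ := {y | -1 * y + (-1) ∈ K} with hK₂
  have hK₁α : HasHoles α K₁ := hKα.preimage one_ne_zero (by simp) _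
  have hK₂α : HasHoles α K₂ := hKα.preimage (by norm_num) (by simp) _
  have hK₁β : UniformlyPerfect β K₁ := hKβ.preimage one_ne_zero (by simp) _
  have hK₂β : UniformlyPerfect β K₂ := hKβ.preimage (by norm_num) (by simp) _
  have hK₁cl : IsClosed K₁ := hK.preimage (by fun_prop)
  have hK₂cl : IsClosed K₂ := hK.preimage (by fun_prop)
  have hDα : HasHoles (α / 2) D := hT.hasHoles_slice hα hWα
  have hDcl : IsClosed D := isClosed_slice hT.isClosed 0
  have hD1 := hT.slice_zero_subset
  set C : Set ℝ := D ∪ (K₁ ∩ {_y | 1 ∈ D} ∪ K₂ ∩ {_y | -1 ∈ D}) with hC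
  have hCmem : ∀ y, y ∈ C ↔ y ∈ D ∨ (y ∈ K₁ ∧ 1 ∈ D ∨ y ∈ K₂ ∧ -1 ∈ D) := fun y => Iff.rfl
  refine ⟨C, ⟨?_, ?_⟩, ?_, hT.eq_horizontalFibers fun y hy => ?_⟩
  · exact hDcl.union ((hK₁cl.inter isClosed_const).union (hK₂cl.inter isClosed_const))
  · have hacc₁ : ∀ y ∈ K₁, 1 ∈ D → AccPt y (𝓟 C) := fun y hy h1 =>
      (hK₁β.accPt hβ hy).mono (principal_mono.2 fun k hk => (hCmem k).2 (Or.inr (Or.inl ⟨hk, h1⟩)))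
    have hacc₂ : ∀ y ∈ K₂, -1 ∈ D → AccPt y (𝓟 C) := fun y hy h1 =>
      (hK₂β.accPt hβ hy).mono (principal_mono.2 fun k hk => (hCmem k).2 (Or.inr (Or.inr ⟨hk, h1⟩)))
    rintro y (hy | ⟨hy, h1⟩ | ⟨hy, h1⟩)
    · rcases (abs_le.2 (hD1 hy)).lt_or_eq with hlt | heq
      · exact (hT.accPt_slice hβ hWβ hy hlt).mono (principal_mono.2 subset_union_left)
      · rcases eq_or_eq_neg_of_abs_eq heq with rfl | rfl
        · exact hacc₁ 1 (by simpa [hK₁] using hK0) hy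
        · exact hacc₂ (-1) (by simpa [hK₂] using hK0) hy
    · exact hacc₁ y hy h1
    · exact hacc₂ y hy h1
  · have hholes : HasHoles (α / 2 * (α * α)) C := by
      intro y r hr hr1
      obtain ⟨y', hy', hole⟩ := (hDα.union (by positivity) (by linarith)
        (hK₁α.union hα hα1 hK₂α)) y r hr hr1
      refine ⟨y', hy', fun k hk => hole k ?_⟩
      rcases hk with hk | hk | hk
      · exact Or.inl hk
      · exact Or.inr (Or.inl hk.1)
      · exact Or.inr (Or.inr hk.1)
    refine hholes.isPorous (by positivity) ?_ ?_
    · have : α * α ≤ 1 := mul_le_one₀ hα1 hα.le hα1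
      nlinarith
    · rintro y (hy | ⟨hy, -⟩ | ⟨hy, -⟩)
      · exact ⟨by linarith [(hD1 hy).1], by linarith [(hD1 hy).2]⟩
      · exact ⟨by linarith [(hK1 hy).1], by linarith [(hK1 hy).2]⟩
      · exact ⟨by linarith [(hK1 hy).2], by linarith [(hK1 hy).1]⟩
  · refine ⟨?_, fun h => Or.inl h⟩
    rintro (h | ⟨h, h1⟩ | ⟨h, h1⟩)
    · exact h
    · rwa [show y = 1 by linarith [(hK1 h).1, hy.2]]
    · rwa [show y = -1 by linarith [(hK1 h).1, hy.1]]

end IsLimitOfProducts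

/-- The blow-up by the factor `1 / t` of the slice of `E` through `x`, centred at `x`. -/
def zoomedSlice (E : Set Plane) (x : Plane) (t : ℝ) : Set ℝ :=
  {η | t * η + x 1 ∈ slice E (x 0)}

/-- At horizontally fibred points tangent sets are limits of products of the line with the
blow-ups of the slice through that point. -/
lemma HorizontallyFibred.isLimitOfProducts {E : Set Plane} {x : Plane}
    (hx : HorizontallyFibred E x) {T : Set Plane} (hTc : IsCompact T) {t : ℕ → ℝ}
    (ht0 : ∀ n, 0 < t n) (ht : Tendsto t atTop (𝓝 0))
    (hT : Tendsto (fun n => Metric.hausdorffEDist (scenery E x (t n)) T) atTop (𝓝 0)) :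
    IsLimitOfProducts T fun n => zoomedSlice E x (t n) := by
  have hH : ∀ ε > 0, ∀ᶠ n in atTop,
      Metric.hausdorffEDist (scenery E x (t n)) T < ENNReal.ofReal ε := fun ε hε =>
    hT.eventually_lt_const (by simpa using hε)
  have hfib : ∀ ε > 0, ∀ᶠ n in atTop, ∀ y ∈ E, dist y x ≤ t n → ∀ s, |s| ≤ t n →
      ∃ y' ∈ E, y' 0 = x 0 + s ∧ |y' 1 - y 1| ≤ ε * t n := fun ε hε =>
    (tendsto_nhdsWithin_iff.2 ⟨ht, Eventually.of_forall ht0⟩).eventually (hx ε hε)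
  have htoT : ∀ ε > 0, ∀ᶠ n in atTop, ∀ z ∈ scenery E x (t n), ∃ z' ∈ T, dist z z' < ε := by
    intro ε hε
    filter_upwards [hH ε hε] with n hn z hz
    obtain ⟨z', hz', h⟩ := Metric.exists_edist_lt_of_hausdorffEDist_lt hz hn
    exact ⟨z', hz', by rwa [edist_dist, ENNReal.ofReal_lt_ofReal_iff hε] at h⟩
  have hfromT : ∀ ε > 0, ∀ᶠ n in atTop, ∀ z ∈ T, ∃ z' ∈ scenery E x (t n), dist z z' < ε := by
    intro ε hε
    filter_upwards [hH ε hε] with n hn z hz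
    rw [Metric.hausdorffEDist_comm] at hn
    obtain ⟨z', hz', h⟩ := Metric.exists_edist_lt_of_hausdorffEDist_lt hz hn
    exact ⟨z', hz', by rwa [edist_dist, ENNReal.ofReal_lt_ofReal_iff hε] at h⟩
  have hball : ∀ n, scenery E x (t n) ⊆ Metric.closedBall 0 1 := by
    rintro n _ ⟨y, ⟨-, hy⟩, rfl⟩
    rw [Metric.mem_closedBall, dist_eq_norm] at hy
    rw [mem_closedBall_zero_iff, norm_smul, norm_inv, Real.norm_of_nonneg (ht0 n).le,
      inv_mul_le_iff₀ (ht0 n), mul_one]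
    exact hy
  refine ⟨hTc.isClosed, ?_, ?_, ?_⟩
  · intro z hz
    rw [mem_closedBall_zero_iff]
    refine le_of_forall_pos_le_add fun ε hε => ?_
    obtain ⟨n, hn⟩ := (hfromT ε hε).exists
    obtain ⟨z', hz', hd⟩ := hn z hz
    have h1 := hball n hz'
    rw [mem_closedBall_zero_iff] at h1
    rw [dist_eq_norm] at hd
    linarith [norm_sub_norm_le z z']
  · intro ε hε
    filter_upwards [hfromT (ε / 2) (by positivity), hfib (ε / 2) (by positivity)] with n h1 h2 z hz
    obtain ⟨_, ⟨y, ⟨hyE, hy⟩, rfl⟩, hd⟩ := h1 z hz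
    obtain ⟨y', hy'E, hy'0, hy'1⟩ := h2 y hyE hy 0 (by simpa using (ht0 n).le)
    have htn := ht0 n
    refine ⟨(y' 1 - x 1) / t n, ?_, ?_⟩
    · rw [zoomedSlice, mem_ofPred_eq, mul_div_cancel₀ _ htn.ne', sub_add_cancel]
      exact snd_mem_slice' hy'E (by simpa using hy'0)
    · have h3 : |z 1 - (t n)⁻¹ * (y 1 - x 1)| ≤ ε / 2 := by
        have := (abs_apply_le_norm (z - (t n)⁻¹ • (y - x)) 1).trans
          ((dist_eq_norm _ _).symm.trans_le hd.le)
        simpa using this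
      have h4 : |(y' 1 - x 1) / t n - (t n)⁻¹ * (y 1 - x 1)| ≤ ε / 2 := by
        have : (y' 1 - x 1) / t n - (t n)⁻¹ * (y 1 - x 1) = (y' 1 - y 1) / t n := by
          field_simp; ring
        rw [this, abs_div, abs_of_pos htn, div_le_iff₀ htn]
        exact hy'1
      rw [abs_sub_comm] at h3
      linarith [abs_sub_le ((y' 1 - x 1) / t n) ((t n)⁻¹ * (y 1 - x 1)) (z 1)]
  · intro ε hε
    filter_upwards [htoT (ε / 2) (by positivity), hfib (ε / 2) (by positivity)] with
      n h1 h2 η hη s hs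
    have htn := ht0 n
    have hη1 : |η| ≤ 1 := by
      have : (|η| + ε) ^ 2 ≤ 1 := by nlinarith [sq_nonneg s]
      nlinarith [abs_nonneg η]
    have hs1 : |s| ≤ 1 := by
      rw [← sq_le_one_iff_abs_le_one]; nlinarith [sq_nonneg (|η| + ε)]
    obtain ⟨y', hy'E, hy'0, hy'1⟩ := h2 _ hη
      (by
        rw [dist_eq_norm]
        refine (norm_le_abs_add_abs _).trans ?_
        simp only [PiLp.sub_apply, Matrix.cons_val_zero, Matrix.cons_val_one,
          Matrix.cons_val_fin_one, sub_self, abs_zero, zero_add, add_sub_cancel_right, abs_mul,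
          abs_of_pos htn]
        nlinarith) (t n * s) (by rw [abs_mul, abs_of_pos htn]; nlinarith)
    simp only [Matrix.cons_val_one, Matrix.cons_val_fin_one] at hy'1
    set w : Plane := (t n)⁻¹ • (y' - x) with hw
    have hw0 : w 0 = s := by
      simp only [hw, PiLp.smul_apply, PiLp.sub_apply, hy'0, smul_eq_mul]; field_simp; ring
    have hw1 : |w 1 - η| ≤ ε / 2 := by
      have : w 1 - η = (y' 1 - (t n * η + x 1)) / t n := by
        simp only [hw, PiLp.smul_apply, PiLp.sub_apply, smul_eq_mul]; field_simp; ring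
      rw [this, abs_div, abs_of_pos htn, div_le_iff₀ htn]
      exact hy'1
    have hwn : ‖w‖ ≤ 1 := by
      have h3 : |w 1| ≤ |η| + ε := by linarith [abs_sub_abs_le_abs_sub (w 1) η]
      have h4 : w 1 ^ 2 ≤ (|η| + ε) ^ 2 := by rw [← sq_abs]; gcongr
      rw [← abs_norm, ← sq_le_one_iff_abs_le_one, norm_sq_plane, hw0]
      linarith
    have hyd : dist y' x ≤ t n := by
      rw [hw, norm_smul, norm_inv, Real.norm_of_nonneg htn.le, inv_mul_le_iff₀ htn, mul_one] at hwn
      rwa [dist_eq_norm]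
    obtain ⟨z, hz, hd⟩ := h1 w ⟨y', ⟨hy'E, hyd⟩, rfl⟩
    rw [dist_comm, dist_eq_norm] at hd
    have h5 := (abs_apply_le_norm (z - w) 0).trans hd.le
    have h6 := (abs_apply_le_norm (z - w) 1).trans hd.le
    rw [PiLp.sub_apply] at h5 h6
    rw [hw0] at h5
    exact ⟨z, hz, by linarith, by linarith [abs_sub_le (z 1) (w 1) η]⟩

/-- Tangent sets of a carpet at horizontally fibred points. -/
theorem HorizontallyFibred.exists_perfect_porous {m : ℕ} {S : Carpet m} {E : Set Plane}
    (hE : IsSelfAffineSet S.map E) {x : Plane} (hx : HorizontallyFibred E x) {T : Set Plane}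
    (hT : IsTangentSet E x T) :
    ∃ C : Set ℝ, Perfect C ∧ IsPorous C ∧ T = horizontalFibers C ∩ Metric.closedBall 0 1 := by
  obtain ⟨hTc, t, ht0, -, ht, hlim⟩ := hT
  obtain ⟨α, hα, hα1, hholes⟩ := Carpet.exists_hasHoles_slice hE
  obtain ⟨β, hβ, hperf⟩ := Carpet.exists_uniformlyPerfect_slice hE
  have ht1 : ∀ᶠ n in atTop, |t n| ≤ 1 :=
    (ht.eventually_le_const one_pos).mono fun n hn => by rwa [abs_of_pos (ht0 n)]
  -- a slice of the carpet, translated so that its lowest point is the origin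
  obtain ⟨z, hz, hz0⟩ := Carpet.exists_mem_fst_eq hE (c := 0) (by simp)
  have hQ : slice E 0 ⊆ Icc 0 1 := fun y hy => by
    simpa using (Carpet.subset_unitSquare hE hy).2
  have hcl : IsClosed (slice E 0) := isClosed_slice hE.1.isClosed 0
  obtain ⟨k, hk, hmin⟩ := (isCompact_Icc.of_isClosed_subset hcl hQ).exists_isLeast
    ⟨z 1, snd_mem_slice' hz hz0⟩
  refine (hx.isLimitOfProducts hTc ht0 ht hlim).exists_perfect_porous
    (K := {y | 1 * y + k ∈ slice E 0}) hα hα1 hβ ?_ ?_ (hcl.preimage (by fun_prop))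
    (by simpa using hk) ?_
    ((hholes 0).preimage one_ne_zero (by simp) k) ((hperf 0).preimage one_ne_zero (by simp) k)
  · filter_upwards [ht1] with n hn using (hholes (x 0)).preimage (ht0 n).ne' hn (x 1)
  · filter_upwards [ht1] with n hn using (hperf (x 0)).preimage (ht0 n).ne' hn (x 1)
  · intro y hy
    have h1 := hmin hy
    have h2 := (hQ hy).2
    have h3 := (hQ hk).1
    exact ⟨by linarith, by linarith⟩

end SelfAffine

/-! ### The coding of the carpet by infinite words -/

namespace SelfAffine

/-- The left shift on infinite words. -/
def shift {α : Type*} (w : ℕ → α) : ℕ → α := fun n => w (n + 1)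

@[simp] lemma shift_apply {α : Type*} (w : ℕ → α) (n : ℕ) : shift w n = w (n + 1) := rfl

lemma measurable_shift {α : Type*} [MeasurableSpace α] : Measurable (shift : (ℕ → α) → ℕ → α) :=
  measurable_pi_lambda _ fun n => measurable_pi_apply (n + 1)

/-- The first `n` letters of an infinite word. -/
def initialWord {α : Type*} (w : ℕ → α) (n : ℕ) : List α := List.ofFn fun k : Fin n => w k

@[simp] lemma initialWord_zero {α : Type*} (w : ℕ → α) : initialWord w 0 = [] := by
  simp [initialWord]

@[simp] lemma length_initialWord {α : Type*} (w : ℕ → α) (n : ℕ) :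
    (initialWord w n).length = n := by simp [initialWord]

lemma initialWord_succ {α : Type*} (w : ℕ → α) (n : ℕ) :
    initialWord w (n + 1) = w 0 :: initialWord (shift w) n := by
  simp [initialWord, List.ofFn_succ]

lemma initialWord_succ' {α : Type*} (w : ℕ → α) (n : ℕ) :
    initialWord w (n + 1) = initialWord w n ++ [w n] := by
  rw [initialWord, List.ofFn_succ', List.concat_eq_append]
  rfl

namespace Carpet

variable {m : ℕ} (S : Carpet m)

/-- The linear parts of the maps of the carpet. -/
def matrix (i : Fin m) : Matrix (Fin 2) (Fin 2) ℝ := Matrix.diagonal ![S.h i, S.v i]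

/-- The translation vectors of the maps of the carpet. -/
noncomputable def translation (i : Fin m) : Plane := !₂[S.a i, S.d i]

/-- The point of the carpet that is coded by an infinite word. -/
noncomputable def code (w : ℕ → Fin m) : Plane := canonicalProjection S.matrix S.translation w

lemma affineMap_eq_map (i : Fin m) : affineMap (S.matrix i) (S.translation i) = S.map i := by
  funext z
  refine plane_ext ?_ ?_ <;> simp [affineMap, matrix, translation]

lemma prod_matrix (u : List (Fin m)) :
    (u.map S.matrix).prod = Matrix.diagonal ![S.width u, S.height u] := by
  induction u with
  | nil =>
    ext i j
    fin_cases i <;> fin_cases j <;> simp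
  | cons i u ih =>
    rw [List.map_cons, List.prod_cons, ih, matrix, Matrix.diagonal_mul_diagonal]
    congr 1
    ext k
    fin_cases k <;> simp

lemma code_term (w : ℕ → Fin m) (n : ℕ) :
    (WithLp.toLp 2 (Matrix.mulVec (List.ofFn fun k : Fin n => S.matrix (w k)).prod
      (S.translation (w n))) : Plane) =
    S.wordMap (initialWord w (n + 1)) 0 - S.wordMap (initialWord w n) 0 := by
  have h : (List.ofFn fun k : Fin n => S.matrix (w k)) = (initialWord w n).map S.matrix := by
    rw [initialWord, List.map_ofFn]; rfl
  rw [h, prod_matrix, initialWord_succ', wordMap_append]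
  refine plane_ext ?_ ?_
  · rw [PiLp.sub_apply, wordMap_fst_sub]
    simp [Matrix.mulVec_diagonal, translation]
  · rw [PiLp.sub_apply, wordMap_snd_sub]
    simp [Matrix.mulVec_diagonal, translation]

lemma norm_wordMap_sub_le {ρ : ℝ} (hρ : ∀ i, S.h i ≤ ρ ∧ S.v i ≤ ρ) (u : List (Fin m))
    (z z' : Plane) :
    ‖S.wordMap u z - S.wordMap u z'‖ ≤ 2 * ‖z - z'‖ * ρ ^ u.length := by
  refine (norm_le_abs_add_abs _).trans ?_
  rw [PiLp.sub_apply, PiLp.sub_apply, wordMap_fst_sub, wordMap_snd_sub, abs_mul, abs_mul,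
    abs_of_pos (S.width_pos u), abs_of_pos (S.height_pos u)]
  have h0 : |z 0 - z' 0| ≤ ‖z - z'‖ := abs_apply_le_norm (z - z') 0
  have h1 : |z 1 - z' 1| ≤ ‖z - z'‖ := abs_apply_le_norm (z - z') 1
  have h2 := mul_le_mul (S.width_le_pow hρ u) h0 (abs_nonneg _)
    ((S.width_pos u).le.trans (S.width_le_pow hρ u))
  have h3 := mul_le_mul (S.height_le_pow hρ u) h1 (abs_nonneg _)
    ((S.height_pos u).le.trans (S.height_le_pow hρ u))
  linarith

lemma tendsto_wordMap_zero (w : ℕ → Fin m) :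
    Tendsto (fun n => S.wordMap (initialWord w n) 0) atTop (𝓝 (S.code w)) := by
  obtain ⟨-, ρ, -, -, hρ0, hρ1, -, hρ⟩ := S.exists_ratio_bounds
  have hsum : Summable fun n : ℕ => (WithLp.toLp 2 (Matrix.mulVec
      (List.ofFn fun k : Fin n => S.matrix (w k)).prod (S.translation (w n))) : Plane) := by
    refine Summable.of_norm_bounded (g := fun n => 4 * ρ ^ n)
      ((summable_geometric_of_lt_one hρ0.le hρ1).mul_left 4) fun n => ?_
    rw [code_term, initialWord_succ', wordMap_append]
    refine (S.norm_wordMap_sub_le hρ _ _ _).trans ?_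
    rw [length_initialWord]
    have h0 : (0 : Plane) ∈ unitSquare := by simp [unitSquare]
    obtain ⟨h1, h2⟩ := S.map_mapsTo (w n) h0
    have : ‖S.map (w n) 0 - 0‖ ≤ 2 := by
      rw [sub_zero]
      refine (norm_le_abs_add_abs _).trans ?_
      rw [abs_of_nonneg h1.1, abs_of_nonneg h2.1]
      linarith [h1.2, h2.2]
    simp only [wordMap_cons, wordMap_nil]
    gcongr
    linarith
  have := hsum.hasSum.tendsto_sum_nat
  refine this.congr fun n => ?_
  simp_rw [code_term]
  rw [Finset.sum_range_sub (fun n => S.wordMap (initialWord w n) 0)]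
  simp

lemma tendsto_wordMap (w : ℕ → Fin m) (z : Plane) :
    Tendsto (fun n => S.wordMap (initialWord w n) z) atTop (𝓝 (S.code w)) := by
  obtain ⟨-, ρ, -, -, hρ0, hρ1, -, hρ⟩ := S.exists_ratio_bounds
  have h : Tendsto (fun n => S.wordMap (initialWord w n) z - S.wordMap (initialWord w n) 0) atTop
      (𝓝 0) := by
    refine squeeze_zero_norm (fun n => S.norm_wordMap_sub_le hρ _ z 0) ?_
    simp_rw [length_initialWord]
    simpa using (tendsto_pow_atTop_nhds_zero_of_lt_one hρ0.le hρ1).const_mul (2 * ‖z - 0‖)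
  simpa using h.add (S.tendsto_wordMap_zero w)

lemma continuous_map (i : Fin m) : Continuous (S.map i) := by
  unfold map
  fun_prop

lemma map_code_shift (w : ℕ → Fin m) : S.map (w 0) (S.code (shift w)) = S.code w := by
  refine tendsto_nhds_unique (((S.continuous_map (w 0)).tendsto _).comp
    (S.tendsto_wordMap_zero (shift w))) ?_
  refine ((S.tendsto_wordMap_zero w).comp (tendsto_add_atTop_nat 1)).congr fun n => ?_
  simp [initialWord_succ]

lemma wordMap_code_shift (w : ℕ → Fin m) (n : ℕ) :
    S.wordMap (initialWord w n) (S.code (shift^[n] w)) = S.code w := by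
  induction n generalizing w with
  | zero => simp
  | succ n ih => rw [initialWord_succ, wordMap_cons, Function.iterate_succ_apply, ih,
      map_code_shift]

variable {S} in
lemma code_mem {E : Set Plane} (hE : IsSelfAffineSet S.map E) (w : ℕ → Fin m) : S.code w ∈ E := by
  obtain ⟨z, hz⟩ := hE.2.1
  exact hE.1.isClosed.mem_of_tendsto (S.tendsto_wordMap w z)
    (Eventually.of_forall fun n => wordMap_mem_attractor hE _ hz)

variable {S} in
lemma code_mem_unitSquare {E : Set Plane} (hE : IsSelfAffineSet S.map E) (w : ℕ → Fin m) :
    S.code w ∈ unitSquare := subset_unitSquare hE (code_mem hE w)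

variable {S} in
lemma code_mem_image_iff {E : Set Plane} (hE : IsSelfAffineSet S.map E) (w : ℕ → Fin m)
    (i : Fin m) : S.code w ∈ S.map i '' unitSquare ↔ w 0 = i := by
  constructor
  · rintro ⟨q, hq, h⟩
    rw [← map_code_shift] at h
    exact (S.eq_of_map_eq hq (code_mem_unitSquare hE _) h).1.symm
  · rintro rfl
    exact ⟨_, code_mem_unitSquare hE _, S.map_code_shift w⟩

variable {S} in
lemma code_injective {E : Set Plane} (hE : IsSelfAffineSet S.map E) :
    Function.Injective S.code := by
  intro w w' h
  funext n
  induction n generalizing w w' with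
  | zero =>
    rw [← code_mem_image_iff hE, h, code_mem_image_iff hE]
  | succ n ih =>
    rw [← map_code_shift, ← map_code_shift S w'] at h
    exact ih (S.eq_of_map_eq (code_mem_unitSquare hE _) (code_mem_unitSquare hE _) h).2

lemma measurable_code : Measurable S.code := by
  have hmap : Measurable fun x : Fin m × Plane => S.map x.1 x.2 :=
    measurable_from_prod_countable_right fun i => (S.continuous_map i).measurable
  refine measurable_of_tendsto_metrizable (f := fun n w => S.wordMap (initialWord w n) 0)
    (fun n => ?_) (tendsto_pi_nhds.2 fun w => S.tendsto_wordMap_zero w)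
  induction n with
  | zero => simp
  | succ n ih =>
    simp_rw [initialWord_succ, wordMap_cons]
    exact hmap.comp ((measurable_pi_apply 0).prodMk (ih.comp measurable_shift))

end Carpet
end SelfAffine

/-! ### The Bernoulli measure -/

namespace SelfAffine

/-- The infinite word with first letter `x.1` and tail `x.2`. -/
def consWord {α : Type*} (x : α × (ℕ → α)) : ℕ → α
  | 0 => x.1
  | n + 1 => x.2 n

@[simp] lemma consWord_zero {α : Type*} (x : α × (ℕ → α)) : consWord x 0 = x.1 := rfl

@[simp] lemma shift_consWord {α : Type*} (x : α × (ℕ → α)) : shift (consWord x) = x.2 := rfl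

lemma measurable_consWord {α : Type*} [MeasurableSpace α] :
    Measurable (consWord : α × (ℕ → α) → ℕ → α) := by
  refine measurable_pi_lambda _ fun n => ?_
  cases n with
  | zero => exact measurable_fst
  | succ n => exact (measurable_pi_apply n).comp measurable_snd

section Bernoulli

variable {m : ℕ} (p : PMF (Fin m))

instance : IsProbabilityMeasure (bernoulliMeasure p) := by
  unfold bernoulliMeasure
  infer_instance

lemma map_eval_bernoulliMeasure (n : ℕ) :
    (bernoulliMeasure p).map (fun w => w n) = p.toMeasure :=
  Measure.infinitePi_map_eval _ n

lemma measurePreserving_shift :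
    MeasurePreserving (shift : (ℕ → Fin m) → ℕ → Fin m) (bernoulliMeasure p)
      (bernoulliMeasure p) :=
  ⟨measurable_shift, Measure.map_infinitePi_infinitePi_of_inj (Nat.succ_injective)⟩

/-- A random word consists of a random letter and an independent random word. -/
lemma map_consWord_bernoulliMeasure :
    (p.toMeasure.prod (bernoulliMeasure p)).map consWord = bernoulliMeasure p := by
  refine Measure.eq_infinitePi _ fun s t ht => ?_
  -- the box `s.pi t`, written with the index set `range (N + 1)`
  classical
  obtain ⟨N, hN⟩ : ∃ N, s ⊆ Finset.range (N + 1) :=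
    ⟨s.sup id, fun k hk => Finset.mem_range.2 (Nat.lt_succ_of_le (Finset.le_sup (f := id) hk))⟩
  set t' : ℕ → Set (Fin m) := fun k => if k ∈ s then t k else univ with ht'
  have ht'm : ∀ k, MeasurableSet (t' k) := fun k => by
    simp only [ht']; split_ifs; exacts [ht k, MeasurableSet.univ]
  have hbox : (s : Set ℕ).pi t = (Finset.range (N + 1) : Set ℕ).pi t' := by
    ext w
    simp only [Set.mem_pi, Finset.mem_coe, ht']
    constructor
    · intro h k _
      split_ifs with hk
      exacts [h k hk, mem_univ _]
    · intro h k hk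
      simpa [hk] using h k (hN hk)
  have hprod : ∏ k ∈ s, p.toMeasure (t k) = ∏ k ∈ Finset.range (N + 1), p.toMeasure (t' k) := by
    rw [← Finset.prod_subset hN fun k _ hk => by simp [ht', hk]]
    exact Finset.prod_congr rfl fun k hk => by simp [ht', hk]
  have hpre : consWord ⁻¹' (Finset.range (N + 1) : Set ℕ).pi t' =
      t' 0 ×ˢ (Finset.range N : Set ℕ).pi fun k => t' (k + 1) := by
    ext x
    simp only [Set.mem_preimage, Set.mem_pi, Finset.mem_coe, Finset.mem_range, Set.mem_prod]
    constructor
    · exact fun h => ⟨h 0 (by lia), fun k hk => h (k + 1) (by lia)⟩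
    · rintro ⟨h0, h⟩ (_ | k) hk
      exacts [h0, h k (by lia)]
  rw [hprod, hbox, Measure.map_apply measurable_consWord
    (MeasurableSet.pi (Finset.countable_toSet _) fun k _ => ht'm k), hpre, Measure.prod_prod,
    bernoulliMeasure, Measure.infinitePi_pi _ fun k _ => ht'm (k + 1), Finset.prod_range_succ',
    mul_comm]

/-- Conditioning on the first letter. -/
lemma bernoulliMeasure_real_eq_sum {s : Set (ℕ → Fin m)} (hs : MeasurableSet s) :
    (bernoulliMeasure p).real s =
      ∑ i, (p i).toReal * (bernoulliMeasure p).real {w | consWord (i, w) ∈ s} := by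
  conv_lhs => rw [← map_consWord_bernoulliMeasure]
  rw [Measure.real, Measure.map_apply measurable_consWord hs,
    Measure.prod_apply (measurable_consWord hs), lintegral_fintype, ENNReal.toReal_sum]
  · refine Finset.sum_congr rfl fun i _ => ?_
    rw [ENNReal.toReal_mul, mul_comm, p.toMeasure_apply_singleton i (measurableSet_singleton i)]
    rfl
  · exact fun i _ => ENNReal.mul_ne_top (measure_ne_top _ _) (measure_ne_top _ _)

lemma sum_toReal_eq_one : ∑ i, (p i).toReal = 1 := by
  rw [← ENNReal.toReal_sum fun i _ => p.apply_ne_top i, ← tsum_fintype (L := .unconditional _),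
    p.tsum_coe, ENNReal.toReal_one]

end Bernoulli

namespace Carpet

variable {m : ℕ} (S : Carpet m) (p : PMF (Fin m))

/-- The measure of the vertical strip with half-width `r` around the abscissa `e`. -/
noncomputable def stripMeasure (e r : ℝ) : ℝ :=
  (bernoulliMeasure p).real {w | |S.code w 0 - e| ≤ r}

lemma measurable_code_fst : Measurable fun w => S.code w 0 :=
  (by fun_prop : Measurable fun z : Plane => z 0).comp S.measurable_code

lemma measurableSet_strip (e r : ℝ) : MeasurableSet {w | |S.code w 0 - e| ≤ r} :=
  measurableSet_le ((S.measurable_code_fst.sub_const e).abs) measurable_const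

lemma stripMeasure_le_one (e r : ℝ) : S.stripMeasure p e r ≤ 1 := measureReal_le_one

/-- Self-similarity of the horizontal projection of the Bernoulli measure. -/
lemma stripMeasure_eq_sum (e r : ℝ) : S.stripMeasure p e r =
    ∑ i, (p i).toReal * S.stripMeasure p ((e - S.a i) / S.h i) (r / S.h i) := by
  rw [stripMeasure, bernoulliMeasure_real_eq_sum p (S.measurableSet_strip e r)]
  refine Finset.sum_congr rfl fun i _ => ?_
  rw [stripMeasure]
  congr 2
  ext w
  have hh := S.h_pos i
  have : S.code (consWord (i, w)) 0 - e = S.h i * (S.code w 0 - (e - S.a i) / S.h i) := by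
    rw [← map_code_shift, map_fst]
    simp only [consWord_zero, shift_consWord]
    field_simp
    ring
  rw [mem_ofPred_eq, mem_ofPred_eq, mem_ofPred_eq, this, abs_mul, abs_of_pos hh, le_div_iff₀ hh,
    mul_comm]

variable {S} {p}

/-- A bound for the measure of all narrow strips improves if, after `k` applications of the
inverse of one of the maps, the strip leaves the unit square. -/
lemma stripMeasure_le_of_iterate {κ : ℝ} (hκ0 : 0 < κ) (hκ1 : κ ≤ 1) (hκ : ∀ i, κ ≤ S.h i)
    {M R : ℝ} (hM : ∀ e r, 0 ≤ r → r ≤ R → S.stripMeasure p e r ≤ M)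
    (i : Fin m) (k : ℕ) {e r : ℝ} (hr : 0 ≤ r) (hrR : r ≤ R * κ ^ k)
    (hzero : S.stripMeasure p ((fun x => (x - S.a i) / S.h i)^[k] e) (r / S.h i ^ k) = 0) :
    S.stripMeasure p e r ≤ (1 - (p i).toReal ^ k) * M := by
  have hdiv : ∀ {c r : ℝ} {n : ℕ} (l : Fin m), 0 ≤ c → r ≤ c * κ ^ (n + 1) →
      r / S.h l ≤ c * κ ^ n := by
    intro c r n l hc h
    rw [div_le_iff₀ (S.h_pos l)]
    calc r ≤ c * κ ^ n * κ := by rw [mul_assoc, ← pow_succ]; exact h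
      _ ≤ c * κ ^ n * S.h l := by gcongr; exact hκ l
  induction k generalizing e r with
  | zero => simpa using hzero.le
  | succ k ih =>
    have hR : 0 ≤ R := by
      by_contra! h
      linarith [mul_neg_of_neg_of_pos h (pow_pos hκ0 (k + 1))]
    have hp0 : 0 ≤ (p i).toReal := ENNReal.toReal_nonneg
    have hsplit : ∑ l, (p l).toReal * (if l = i then (1 - (p i).toReal ^ k) * M else M) =
        (1 - (p i).toReal ^ (k + 1)) * M := by
      have h1 : ∀ l, (p l).toReal * (if l = i then (1 - (p i).toReal ^ k) * M else M) =
          (p l).toReal * M - (if l = i then (p i).toReal ^ (k + 1) * M else 0) := by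
        intro l
        split_ifs with h
        · subst h; ring
        · ring
      simp_rw [h1]
      rw [Finset.sum_sub_distrib, ← Finset.sum_mul, sum_toReal_eq_one, Finset.sum_ite_eq']
      simp
      ring
    rw [stripMeasure_eq_sum, ← hsplit]
    refine Finset.sum_le_sum fun l _ => mul_le_mul_of_nonneg_left ?_ ENNReal.toReal_nonneg
    have hh := S.h_pos l
    split_ifs with h
    · subst h
      refine ih (by positivity) (hdiv l hR hrR) ?_
      rwa [Function.iterate_succ_apply, pow_succ', ← div_div] at hzero
    · refine hM _ _ (by positivity) ((hdiv l hR hrR).trans ?_)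
      exact mul_le_of_le_one_right hR (pow_le_one₀ hκ0.le hκ1)

lemma stripMeasure_eq_zero {E : Set Plane} (hE : IsSelfAffineSet S.map E) {e r : ℝ}
    (h : 1 < e - r ∨ e + r < 0) : S.stripMeasure p e r = 0 := by
  have : {w | |S.code w 0 - e| ≤ r} = ∅ := by
    ext w
    have hw := (code_mem_unitSquare hE w).1
    simp only [mem_ofPred_eq, mem_empty_iff_false, iff_false, abs_le, not_and_or, not_le]
    rcases h with h | h
    · left; linarith [hw.2]
    · right; linarith [hw.1]
  rw [stripMeasure, this, measureReal_empty]

/-- Narrow vertical strips have small measure, with an exponential rate: one of the maps fixes the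
left side of the unit square and another one its right side, so a narrow strip is disjoint from the
`k`-th iterate of the unit square under one of these two maps. -/
lemma exists_stripMeasure_le_pow {E : Set Plane} (hE : IsSelfAffineSet S.map E)
    (hp : ∀ i, 0 < p i) : ∃ κ θ : ℝ, 0 < κ ∧ κ < 1 ∧ 0 < θ ∧ θ < 1 ∧
      ∀ (n : ℕ) (e r : ℝ), 0 ≤ r → r ≤ 1 / 8 * κ ^ n → S.stripMeasure p e r ≤ θ ^ n := by
  obtain ⟨κ, ρ, hκ0, hκ1, hρ0, hρ1, hκ, hρ⟩ := S.exists_ratio_bounds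
  obtain ⟨i, -, -, hi, -⟩ := S.cover 0 (by simp)
  obtain ⟨j, -, -, hj, -⟩ := S.cover 1 (by simp)
  have hai : S.a i = 0 := le_antisymm hi.1 (S.a_nonneg i)
  have haj : S.a j = 1 - S.h j := by linarith [S.a_add_h_le j, hj.2]
  obtain ⟨k, hk⟩ := exists_pow_lt_of_lt_one (show (0 : ℝ) < 1 / 4 by norm_num) hρ1
  have hk0 : k ≠ 0 := by
    rintro rfl
    norm_num at hk
  have hp0 : ∀ i, 0 < (p i).toReal := fun i => ENNReal.toReal_pos (hp i).ne' (p.apply_ne_top i)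
  have hhi : ∀ l, 0 < S.h l ^ k ∧ S.h l ^ k < 1 / 4 := fun l =>
    ⟨pow_pos (S.h_pos l) k, (pow_le_pow_left₀ (S.h_pos l).le (hρ l).1 k).trans_lt hk⟩
  have hiti : ∀ (n : ℕ) (e : ℝ), (fun x => (x - S.a i) / S.h i)^[n] e = e / S.h i ^ n := by
    intro n e
    induction n with
    | zero => simp
    | succ n ih => rw [Function.iterate_succ_apply', ih, hai, sub_zero, div_div, pow_succ]
  have hitj : ∀ (n : ℕ) (e : ℝ),
      (fun x => (x - S.a j) / S.h j)^[n] e = 1 - (1 - e) / S.h j ^ n := by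
    intro n e
    induction n with
    | zero => simp
    | succ n ih =>
      have := (S.h_pos j).ne'
      rw [Function.iterate_succ_apply', ih, haj]
      field_simp
      ring
  set θ : ℝ := max (1 / 2) (1 - min ((p i).toReal ^ k) ((p j).toReal ^ k)) with hθ
  have hθ1 : θ < 1 := max_lt (by norm_num) (by
    have : 0 < min ((p i).toReal ^ k) ((p j).toReal ^ k) :=
      lt_min (pow_pos (hp0 i) k) (pow_pos (hp0 j) k)
    linarith)
  have hθ0 : 0 < θ := lt_of_lt_of_le (by norm_num) (le_max_left _ _)
  have hθi : 1 - (p i).toReal ^ k ≤ θ := le_trans (by gcongr; exact min_le_left _ _)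
    (le_max_right _ _)
  have hθj : 1 - (p j).toReal ^ k ≤ θ := le_trans (by gcongr; exact min_le_right _ _)
    (le_max_right _ _)
  refine ⟨κ ^ k, θ, pow_pos hκ0 k, pow_lt_one₀ hκ0.le hκ1 hk0, hθ0, hθ1, fun n => ?_⟩
  induction n with
  | zero => intro e r _ _; simpa using S.stripMeasure_le_one p e r
  | succ n ih =>
    intro e r hr hrn
    have hκn : (κ ^ k) ^ (n + 1) ≤ 1 := pow_le_one₀ (by positivity) (pow_le_one₀ hκ0.le hκ1.le)
    have hr8 : r ≤ 1 / 8 := by linarith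
    rw [pow_succ, ← mul_assoc] at hrn
    rw [pow_succ']
    by_cases he : 1 / 2 ≤ e
    · refine (stripMeasure_le_of_iterate hκ0 hκ1.le (fun l => (hκ l).1) ih i k hr
        hrn (stripMeasure_eq_zero hE (Or.inl ?_))).trans (by gcongr)
      rw [hiti, ← sub_div, one_lt_div (hhi i).1]
      linarith [(hhi i).2]
    · refine (stripMeasure_le_of_iterate hκ0 hκ1.le (fun l => (hκ l).1) ih j k hr
        hrn (stripMeasure_eq_zero hE (Or.inr ?_))).trans (by gcongr)
      push Not at he
      have : 1 < (1 - e - r) / S.h j ^ k := by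
        rw [one_lt_div (hhi j).1]
        linarith [(hhi j).2]
      rw [hitj]
      rw [sub_div] at this
      linarith

lemma exists_stripMeasure_le_rpow {E : Set Plane} (hE : IsSelfAffineSet S.map E)
    (hp : ∀ i, 0 < p i) : ∃ C s : ℝ, 0 < s ∧
      ∀ e r : ℝ, 0 < r → S.stripMeasure p e r ≤ C * r ^ s := by
  obtain ⟨κ, θ, hκ0, hκ1, hθ0, hθ1, h⟩ := exists_stripMeasure_le_pow hE hp
  set s := Real.log θ / Real.log κ with hs
  have hs0 : 0 < s := div_pos_of_neg_of_neg (Real.log_neg hθ0 hθ1) (Real.log_neg hκ0 hκ1)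
  have hκs : κ ^ s = θ := by
    rw [Real.rpow_def_of_pos hκ0, hs, mul_div_cancel₀ _ (Real.log_neg hκ0 hκ1).ne,
      Real.exp_log hθ0]
  refine ⟨(8 / κ) ^ s, s, hs0, fun e r hr => ?_⟩
  rw [← Real.mul_rpow (by positivity) hr.le]
  by_cases hr8 : 8 * r ≤ 1
  · obtain ⟨n, hn, hn'⟩ := exists_nat_pow_near_of_lt_one (by positivity) hr8 hκ0 hκ1
    refine (h n e r hr.le (by linarith)).trans ?_
    rw [← hκs, ← Real.rpow_natCast, ← Real.rpow_mul hκ0.le, mul_comm s, Real.rpow_mul hκ0.le,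
      Real.rpow_natCast]
    refine Real.rpow_le_rpow (by positivity) ?_ hs0.le
    rw [div_mul_eq_mul_div, le_div_iff₀ hκ0, ← pow_succ]
    exact hn.le
  · refine (S.stripMeasure_le_one p e r).trans (Real.one_le_rpow ?_ hs0.le)
    rw [div_mul_eq_mul_div, one_le_div hκ0]
    linarith

/-- Almost surely the horizontal positions of the shifted points approach a given abscissa more
slowly than a given geometric sequence. -/
lemma ae_eventually_lt_abs_code_shift_sub {E : Set Plane} (hE : IsSelfAffineSet S.map E)
    (hp : ∀ i, 0 < p i) {q : ℝ} (hq0 : 0 < q) (hq1 : q < 1) (e : ℝ) :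
    ∀ᵐ w ∂(bernoulliMeasure p), ∀ᶠ n in atTop, q ^ n < |S.code (shift^[n] w) 0 - e| := by
  obtain ⟨C, s, hs, hC⟩ := exists_stripMeasure_le_rpow hE hp
  have hmeas : ∀ n : ℕ, bernoulliMeasure p {w | |S.code (shift^[n] w) 0 - e| ≤ q ^ n} ≤
      ENNReal.ofReal (C * (q ^ s) ^ n) := by
    intro n
    have h1 := ((measurePreserving_shift p).iterate n).measure_preimage
      (S.measurableSet_strip e (q ^ n)).nullMeasurableSet
    rw [show {w | |S.code (shift^[n] w) 0 - e| ≤ q ^ n} =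
      shift^[n] ⁻¹' {w | |S.code w 0 - e| ≤ q ^ n} from rfl, h1,
      ← ENNReal.ofReal_toReal (measure_ne_top (bernoulliMeasure p) _)]
    refine ENNReal.ofReal_le_ofReal ((hC e (q ^ n) (pow_pos hq0 n)).trans_eq ?_)
    rw [← Real.rpow_natCast, ← Real.rpow_natCast, ← Real.rpow_mul hq0.le, ← Real.rpow_mul hq0.le,
      mul_comm s]
  have hsum : Summable fun n : ℕ => C * (q ^ s) ^ n :=
    (summable_geometric_of_lt_one (by positivity) (Real.rpow_lt_one hq0.le hq1 hs)).mul_left C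
  filter_upwards [ae_eventually_notMem
    (ne_top_of_le_ne_top hsum.tsum_ofReal_ne_top (ENNReal.tsum_le_tsum hmeas))] with w hw
  exact hw.mono fun n hn => not_le.1 hn

/-- By the law of large numbers, almost surely the ratios of height to width of the cylinders
decay exponentially. -/
lemma exists_ae_eventually_height_div_width_le
    (hlyap : 0 < ∑ i, (p i).toReal * (Real.log (S.h i) - Real.log (S.v i))) :
    ∃ q : ℝ, 0 < q ∧ q < 1 ∧ ∀ᵐ w ∂(bernoulliMeasure p), ∀ᶠ n in atTop,
      S.height (initialWord w n) / S.width (initialWord w n) ≤ q ^ n := by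
  set φ : Fin m → ℝ := fun i => Real.log (S.h i) - Real.log (S.v i) with hφ
  set l := ∑ i, (p i).toReal * φ i with hl
  have hφm : Measurable φ := measurable_of_finite φ
  have hlaw : ∀ n : ℕ, Measurable fun w : ℕ → Fin m => φ (w n) := fun n =>
    hφm.comp (measurable_pi_apply n)
  have hmean : ∫ w, φ (w 0) ∂(bernoulliMeasure p) = l := by
    have := integral_map (μ := bernoulliMeasure p) (φ := fun w : ℕ → Fin m => w 0) (f := φ)
      (measurable_pi_apply 0).aemeasurable hφm.aestronglyMeasurable
    rw [← this, map_eval_bernoulliMeasure, PMF.integral_eq_sum]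
    simp [hl]
  have hint : Integrable (fun w : ℕ → Fin m => φ (w 0)) (bernoulliMeasure p) := by
    obtain ⟨B, hB⟩ := (Set.finite_range fun i => ‖φ i‖).bddAbove
    exact Integrable.of_bound (hlaw 0).aestronglyMeasurable B
      (Eventually.of_forall fun w => hB ⟨w 0, rfl⟩)
  have hslln := ProbabilityTheory.strong_law_ae_real (μ := bernoulliMeasure p)
    (fun n (w : ℕ → Fin m) => φ (w n)) hint
    (fun i j hij => (ProbabilityTheory.iIndepFun_infinitePi (P := fun _ : ℕ => p.toMeasure)
      (X := fun _ : ℕ => φ) fun _ => hφm).indepFun hij)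
    (fun n => ⟨(hlaw n).aemeasurable, (hlaw 0).aemeasurable, by
      have hcomp : ∀ k : ℕ, (bernoulliMeasure p).map (fun w => φ (w k)) = p.toMeasure.map φ :=
        fun k => by
          rw [← map_eval_bernoulliMeasure p k, Measure.map_map hφm (measurable_pi_apply k)]
          rfl
      rw [hcomp, hcomp]⟩)
  have hsum : ∀ (w : ℕ → Fin m) (n : ℕ), S.height (initialWord w n) / S.width (initialWord w n) =
      Real.exp (-∑ k ∈ Finset.range n, φ (w k)) := by
    intro w n
    induction n with
    | zero => simp
    | succ n ih =>
      rw [initialWord_succ', height_append, width_append, mul_div_mul_comm, ih,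
        Finset.sum_range_succ, neg_add, Real.exp_add]
      simp only [height_cons, height_nil, width_cons, width_nil, mul_one, hφ, neg_sub]
      rw [Real.exp_sub, Real.exp_log (S.v_pos _), Real.exp_log (S.h_pos _)]
  refine ⟨Real.exp (-(l / 2)), Real.exp_pos _,
    (Real.exp_lt_exp.2 (by linarith)).trans_eq Real.exp_zero, ?_⟩
  filter_upwards [hslln] with w hw
  rw [hmean] at hw
  filter_upwards [hw.eventually_const_lt (show l / 2 < l by linarith), eventually_gt_atTop 0] with
    n hn hn0
  have hn0' : (0 : ℝ) < n := by exact_mod_cast hn0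
  rw [lt_div_iff₀ hn0'] at hn
  rw [hsum, ← Real.exp_nat_mul]
  exact Real.exp_le_exp.2 (by linarith)

/-- Almost every point is horizontally fibred. -/
theorem ae_horizontallyFibred {E : Set Plane} (hE : IsSelfAffineSet S.map E)
    (hp : ∀ i, 0 < p i)
    (hlyap : 0 < ∑ i, (p i).toReal * (Real.log (S.h i) - Real.log (S.v i))) :
    ∀ᵐ w ∂(bernoulliMeasure p), HorizontallyFibred E (S.code w) := by
  obtain ⟨κ, ρ, hκ0, -, hρ0, hρ1, hκ, hρ⟩ := S.exists_ratio_bounds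
  obtain ⟨q, hq0, hq1, hq⟩ := exists_ae_eventually_height_div_width_le hlyap
  have hgen : ∀ᵐ w ∂(bernoulliMeasure p), ∀ u : List (Fin m), ∀ᶠ n in atTop,
      q ^ n < |S.code (shift^[n] w) 0 - S.wordMap u 0 0| ∧
      q ^ n < |S.code (shift^[n] w) 0 - (S.wordMap u 0 0 + S.width u)| := by
    rw [ae_all_iff]
    intro u
    filter_upwards [ae_eventually_lt_abs_code_shift_sub hE hp hq0 hq1 (S.wordMap u 0 0),
      ae_eventually_lt_abs_code_shift_sub hE hp hq0 hq1 (S.wordMap u 0 0 + S.width u)] with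
      w h1 h2 using h1.and h2
  filter_upwards [hq, hgen] with w hw hw'
  refine horizontallyFibred_of_generic hE (initialWord w) (fun n => S.code (shift^[n] w))
    (fun n => code_mem hE _) (fun n => S.wordMap_code_shift w n) hκ0 (fun n => ?_) ?_ fun u => ?_
  · rw [initialWord_succ', height_append, mul_comm]
    simp only [height_cons, height_nil, mul_one]
    exact mul_le_mul_of_nonneg_left (hκ _).2 (S.height_pos _).le
  · refine squeeze_zero (fun n => (S.height_pos _).le) (fun n => S.height_le_pow hρ _) ?_
    simp_rw [length_initialWord]
    exact tendsto_pow_atTop_nhds_zero_of_lt_one hρ0.le hρ1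
  · filter_upwards [hw, hw' u] with n h1 h2
    exact ⟨h1.trans_lt h2.1, h1.trans_lt h2.2⟩

/-- The measure of the first generation rectangles. -/
lemma projectedBernoulli_real_image {E : Set Plane} (hE : IsSelfAffineSet S.map E) (i : Fin m) :
    (projectedBernoulli S.matrix S.translation p).real (S.map i '' unitSquare) =
      (p i).toReal := by
  have hmeas : MeasurableSet (S.map i '' unitSquare) := by
    rw [map_image_unitSquare]
    exact ((by fun_prop : Measurable fun z : Plane => z 0) measurableSet_Icc).inter
      ((by fun_prop : Measurable fun z : Plane => z 1) measurableSet_Icc)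
  have hpre : S.code ⁻¹' (S.map i '' unitSquare) = (fun w => w 0) ⁻¹' {i} := by
    ext w
    exact code_mem_image_iff hE w i
  rw [projectedBernoulli, Measure.real]
  change ((bernoulliMeasure p).map S.code _).toReal = _
  rw [Measure.map_apply S.measurable_code hmeas, hpre,
    ← Measure.map_apply (measurable_pi_apply 0) (measurableSet_singleton i),
    map_eval_bernoulliMeasure, p.toMeasure_apply_singleton i (measurableSet_singleton i)]

end Carpet
end SelfAffine

/-! ### The tangent sets of the carpet -/

theorem corollary1p1 {m : ℕ} (h v : Fin m → ℝ)
    (A : Fin m → Matrix (Fin 2) (Fin 2) ℝ) (b : Fin m → Plane) (f : Fin m → Plane → Plane)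
    (hf : ∀ i, f i = affineMap (A i) (b i))
    (hA : ∀ i, A i = Matrix.diagonal ![h i, v i])
    (hh : ∀ i, 0 < h i ∧ h i < 1) (hv : ∀ i, 0 < v i ∧ v i < 1)
    (hmaps : ∀ i, MapsTo (f i) unitSquare unitSquare)
    (p : PMF (Fin m)) (hp : ∀ i, 0 < p i)
    (hdisj : ∀ i j, i ≠ j → f i '' unitSquare ∩ f j '' unitSquare = ∅)
    (hline : ∀ c ∈ Icc (0 : ℝ) 1,
      2 ≤ {i : Fin m | (verticalSegment c ∩ f i '' unitSquare).Nonempty}.ncard)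
    (hlyap : -∑ i, (projectedBernoulli A b p).real (f i '' unitSquare) * Real.log (h i) <
      -∑ i, (projectedBernoulli A b p).real (f i '' unitSquare) * Real.log (v i))
    (E : Set Plane) (hE : IsSelfAffineSet f E) :
    ∀ᵐ x ∂(projectedBernoulli A b p), ∀ T : Set Plane, IsTangentSet E x T →
      ∃ C : Set ℝ, Perfect C ∧ IsPorous C ∧
        T = horizontalFibers C ∩ Metric.closedBall (0 : Plane) 1 := by
  have hf0 : ∀ i z, f i z 0 = h i * z 0 + b i 0 := fun i z => by
    simp [hf, hA, affineMap]
  have hf1 : ∀ i z, f i z 1 = v i * z 1 + b i 1 := fun i z => by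
    simp [hf, hA, affineMap]
  have h00 : (!₂[0, 0] : Plane) ∈ unitSquare := by simp [unitSquare]
  have h11 : (!₂[1, 1] : Plane) ∈ unitSquare := by simp [unitSquare]
  -- the rectangles in terms of coordinates
  have himage : ∀ i (x y : ℝ), x ∈ Icc (b i 0) (b i 0 + h i) → y ∈ Icc (b i 1) (b i 1 + v i) →
      (!₂[x, y] : Plane) ∈ f i '' unitSquare := by
    intro i x y hx hy
    obtain ⟨hh0, -⟩ := hh i
    obtain ⟨hv0, -⟩ := hv i
    refine ⟨!₂[(x - b i 0) / h i, (y - b i 1) / v i], ⟨⟨?_, ?_⟩, ?_, ?_⟩, plane_ext ?_ ?_⟩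
    · simpa using div_nonneg (by linarith [hx.1]) hh0.le
    · simpa using (div_le_one hh0).2 (by linarith [hx.2])
    · simpa using div_nonneg (by linarith [hy.1]) hv0.le
    · simpa using (div_le_one hv0).2 (by linarith [hy.2])
    · rw [hf0]; simp; field_simp; ring
    · rw [hf1]; simp; field_simp; ring
  let S : Carpet m :=
    { h := h
      v := v
      a := fun i => b i 0
      d := fun i => b i 1
      h_pos := fun i => (hh i).1
      h_lt_one := fun i => (hh i).2
      v_pos := fun i => (hv i).1
      v_lt_one := fun i => (hv i).2
      a_nonneg := fun i => by simpa [hf0] using (hmaps i h00).1.1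
      a_add_h_le := fun i => by simpa [hf0, add_comm] using (hmaps i h11).1.2
      d_nonneg := fun i => by simpa [hf1] using (hmaps i h00).2.1
      d_add_v_le := fun i => by simpa [hf1, add_comm] using (hmaps i h11).2.2
      disjoint := fun i j hij => by
        rw [Set.disjoint_left]
        rintro ⟨x, y⟩ ⟨hx, hy⟩ ⟨hx', hy'⟩
        exact (hdisj i j hij).subset ⟨himage i x y hx hy, himage j x y hx' hy'⟩
      cover := fun c hc => by
        obtain ⟨i, hi, j, hj, hij⟩ := (one_lt_ncard (toFinite _)).1 (hline c hc)
        refine ⟨i, j, hij, ?_, ?_⟩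
        · obtain ⟨_, ⟨hz, -⟩, z, hzQ, rfl⟩ := hi
          rw [← hz, hf0]
          have := (hh i).1
          constructor <;> nlinarith [hzQ.1.1, hzQ.1.2]
        · obtain ⟨_, ⟨hz, -⟩, z, hzQ, rfl⟩ := hj
          rw [← hz, hf0]
          have := (hh j).1
          constructor <;> nlinarith [hzQ.1.1, hzQ.1.2] }
  have hSA : S.matrix = A := funext fun i => (hA i).symm
  have hSb : S.translation = b := funext fun i =>
    plane_ext (by simp [Carpet.translation, S]) (by simp [Carpet.translation, S])
  have hSf : S.map = f := funext fun i => by rw [hf, ← hSA, ← hSb, Carpet.affineMap_eq_map]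
  have hES : IsSelfAffineSet S.map E := hSf ▸ hE
  have hmass : ∀ i, (projectedBernoulli A b p).real (f i '' unitSquare) = (p i).toReal := by
    intro i
    have := Carpet.projectedBernoulli_real_image (p := p) hES i
    rwa [hSA, hSb, hSf] at this
  simp_rw [hmass] at hlyap
  have hlyap' : 0 < ∑ i, (p i).toReal * (Real.log (S.h i) - Real.log (S.v i)) := by
    simp_rw [mul_sub, Finset.sum_sub_distrib]
    exact sub_pos.2 (neg_lt_neg_iff.1 hlyap)
  -- the coding map is injective, so that null sets of words have null images
  have hemb : MeasurableEmbedding S.code :=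
    S.measurable_code.measurableEmbedding (Carpet.code_injective hES)
  rw [← hSA, ← hSb]
  refine hemb.ae_map_iff.2 ?_
  filter_upwards [Carpet.ae_horizontallyFibred hES hp hlyap'] with w hw T hT
  exact hw.exists_perfect_porous hES hT
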